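/- Let $J=\begin{pmatrix}0&1\\-1&0\end{pmatrix}$, $\sigma_1=\begin{pmatrix}0&1\\1&0\end{pmatrix}$, $\sigma_2=iJ=\begin{pmatrix}0&i\\-i&0\end{pmatrix}$, $\sigma_3=\begin{pmatrix}1&0\\0&-1\end{pmatrix}$, and let $\mathbb I$ be the $2\times2$ identity matrix. Let $Q=\begin{pmatrix}q_1&q\\ \overline q&q_2\end{pmatrix}:\mathbb R\to M_2(\mathbb C)$ be Hermitian ($q_1,q_2$ real valued, $q$ complex valued), $\pi$-periodic, and integrable on $[0,\pi)$. For $\lambda\in\mathbb C$ let $\mathbb Y(\cdot,\lambda)$ be the matrix solution on $\mathbb R$, with entries absolutely continuous on compact intervals, of $$J\,\mathbb Y'+Q\,\mathbb Y=\lambda\,\mathbb Y\quad\text{a.e.},\qquad \mathbb Y(0,\lambda)=\mathbb I,$$ and let $\Delta(\lambda)=\operatorname{tr}\mathbb Y(\pi,\lambda)$. Write $Q=Q_1+Q_2$ with $$Q_1=\operatorname{Re}(q)\,\sigma_1+\tfrac12(q_1-q_2)\,\sigma_3,\qquad Q_2=\tfrac12(q_1+q_2)\,\mathbb I+\operatorname{Im}(q)\,\sigma_2,$$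 and put $$R(z)=\exp\Big(J\int_0^z\Big(Q_2(t)-\frac1\pi\int_0^\pi Q_2\,d\tau\Big)dt\Big),\qquad \tilde Q(z)=R(z)^{-1}Q_1(z)R(z)+\frac1\pi\int_0^\pi Q_2\,dt .$$ Say that an analytic function has only double zeros if each of its zeros in $\mathbb C$ has order exactly $2$. Then: (a) If $Q(z+\frac\pi2)=Q(z)$ for a.e. $z\in\mathbb R$, then $\lambda\mapsto\Delta(\lambda)+2e^{-i\int_0^\pi\operatorname{Im}q\,dt}$ has only double zeros. (b) If $\lambda\mapsto\Delta(\lambda)+2e^{-i\int_0^\pi\operatorname{Im}q\,dt}$ has only double zeros, then $\tilde Q(z+\frac\pi2)=\tilde Q(z)$ for a.e. $z\in\mathbb R$. -/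

import Mathlib

namespace DiracSystem

/-! ### Existence of solutions of linear equations with locally integrable coefficients -/

open MeasureTheory intervalIntegral Set in
theorem integral_mul_pow_primitive (a : ℝ → ℝ) (ha : ∀ x y, IntervalIntegrable a volume x y)
    (n : ℕ) (z : ℝ) :
    ∫ t in (0 : ℝ)..z, a t * (∫ s in (0 : ℝ)..t, a s) ^ n
      = (∫ s in (0 : ℝ)..z, a s) ^ (n + 1) / (n + 1) := by
  set α : ℝ → ℝ := fun t => ∫ s in (0 : ℝ)..t, a s with hα
  have hac : AbsolutelyContinuousOnInterval α 0 z :=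
    (ha 0 z).absolutelyContinuousOnInterval_intervalIntegral (by simp)
  have hpow : ∀ m : ℕ, AbsolutelyContinuousOnInterval (fun t => α t ^ (m + 1)) 0 z := by
    intro m
    induction m with
    | zero => simpa using hac
    | succ k ih =>
      have := ih.fun_mul hac
      simpa [pow_succ] using this
  have h1 := (hpow n).integral_deriv_eq_sub
  have h0 : α 0 = 0 := by simp [hα]
  have h2 : ∫ t in (0 : ℝ)..z, deriv (fun t => α t ^ (n + 1)) t
      = ∫ t in (0 : ℝ)..z, (n + 1 : ℝ) * (a t * α t ^ n) := by
    apply intervalIntegral.integral_congr_ae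
    filter_upwards [(ha 0 z).ae_hasDerivAt_integral] with t ht htz
    have hd : HasDerivAt α (a t) t := ht (uIoc_subset_uIcc htz) 0 (by simp)
    have := (hd.fun_pow (n + 1)).deriv
    rw [this]
    push_cast
    ring_nf
    try simp
  rw [h2, intervalIntegral.integral_const_mul, h0] at h1
  have hn : (n + 1 : ℝ) ≠ 0 := by positivity
  simp only [ne_eq, Nat.add_eq_zero_iff, one_ne_zero, and_false, not_false_eq_true, zero_pow,
    sub_zero] at h1
  rw [eq_div_iff hn, ← h1]
  ring

open MeasureTheory intervalIntegral Set Filter in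
theorem exists_volterra {E : Type*} [NormedRing E] [NormedAlgebra ℝ E] [CompleteSpace E]
    (A : ℝ → E) (hA : ∀ x y, IntervalIntegrable A volume x y) :
    ∃ Y : ℝ → E, Continuous Y ∧ ∀ z, Y z = 1 + ∫ t in (0 : ℝ)..z, A t * Y t := by
  set a : ℝ → ℝ := fun t => ‖A t‖ with ha_def
  have ha : ∀ x y, IntervalIntegrable a volume x y := fun x y => (hA x y).norm
  set α : ℝ → ℝ := fun t => ∫ s in (0 : ℝ)..t, a s with hα
  have hαc : Continuous α := intervalIntegral.continuous_primitive ha 0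
  let u : ℕ → ℝ → E := fun n =>
    Nat.rec (fun _ => 1) (fun _ v z => ∫ t in (0 : ℝ)..z, A t * v t) n
  have hu0 : ∀ z, u 0 z = 1 := fun z => rfl
  have hus : ∀ n z, u (n + 1) z = ∫ t in (0 : ℝ)..z, A t * u n t := fun n z => rfl
  have hmul : ∀ v : ℝ → E, Continuous v → ∀ x y, IntervalIntegrable (fun t => A t * v t) volume x y :=
    fun v hv x y => (hA x y).mul_continuousOn hv.continuousOn
  have huc : ∀ n, Continuous (u n) := by
    intro n
    induction n with
    | zero => exact continuous_const
    | succ k ih => exact intervalIntegral.continuous_primitive (hmul _ ih) 0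
  set C : ℝ := ‖(1 : E)‖ with hC
  have hbound : ∀ n z, ‖u n z‖ ≤ C * (|α z| ^ n / n.factorial) := by
    intro n
    induction n with
    | zero => intro z; simp [hu0, hC]
    | succ k ih =>
      intro z
      have hbi : IntervalIntegrable (fun t => a t * (C * (|α t| ^ k / k.factorial))) volume 0 z :=
        (ha 0 z).mul_continuousOn (by fun_prop)
      have h1 : ‖u (k + 1) z‖ ≤ |∫ t in (0 : ℝ)..z, a t * (C * (|α t| ^ k / k.factorial))| := by
        rw [hus]
        refine intervalIntegral.norm_integral_le_abs_of_norm_le ?_ hbi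
        refine Eventually.of_forall fun t => ?_
        calc ‖A t * u k t‖ ≤ ‖A t‖ * ‖u k t‖ := norm_mul_le _ _
          _ ≤ _ := mul_le_mul_of_nonneg_left (ih t) (norm_nonneg _)
      refine h1.trans ?_
      obtain ⟨s, hs, hst⟩ : ∃ s : ℝ, |s| = 1 ∧ ∀ t ∈ uIcc 0 z, |α t| = s * α t := by
        rcases le_total 0 z with hz | hz
        · refine ⟨1, by simp, fun t ht => ?_⟩
          rw [uIcc_of_le hz] at ht
          rw [one_mul, abs_of_nonneg]
          exact intervalIntegral.integral_nonneg ht.1 fun _ _ => norm_nonneg _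
        · refine ⟨-1, by simp, fun t ht => ?_⟩
          rw [uIcc_of_ge hz] at ht
          rw [neg_one_mul, abs_of_nonpos]
          change (∫ s in (0 : ℝ)..t, a s) ≤ 0
          rw [intervalIntegral.integral_symm]
          exact neg_nonpos.mpr (intervalIntegral.integral_nonneg ht.2 fun _ _ => norm_nonneg _)
      have h2 : ∫ t in (0 : ℝ)..z, a t * (C * (|α t| ^ k / k.factorial))
          = (C / k.factorial * s ^ k) * ∫ t in (0 : ℝ)..z, a t * α t ^ k := by
        rw [← intervalIntegral.integral_const_mul]
        refine intervalIntegral.integral_congr fun t ht => ?_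
        rw [hst t ht]
        ring
      rw [h2, integral_mul_pow_primitive a ha k z]
      rw [abs_mul, abs_mul, abs_pow, hs, one_pow, mul_one, abs_div, abs_div, abs_pow]
      rw [abs_of_nonneg (norm_nonneg (1 : E)), abs_of_nonneg (by positivity : (0 : ℝ) ≤ k.factorial),
        abs_of_nonneg (by positivity : (0 : ℝ) ≤ (k : ℝ) + 1)]
      apply le_of_eq
      rw [Nat.factorial_succ]
      push_cast
      have : (k.factorial : ℝ) ≠ 0 := by positivity
      have : (k : ℝ) + 1 ≠ 0 := by positivity
      field_simp
      rfl
  have hloc : ∀ r : ℝ, ∃ M : ℝ, 0 ≤ M ∧ ∀ n, ∀ z ∈ Icc (-r) r, ‖u n z‖ ≤ C * (M ^ n / n.factorial) := by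
    intro r
    obtain ⟨M, hM⟩ := (isCompact_Icc (a := -r) (b := r)).exists_bound_of_continuousOn hαc.continuousOn
    refine ⟨max M 0, le_max_right _ _, fun n z hz => (hbound n z).trans ?_⟩
    have : |α z| ≤ max M 0 := (hM z hz).trans (le_max_left _ _)
    gcongr
  have hsumm : ∀ M : ℝ, Summable fun n : ℕ => C * (M ^ n / n.factorial) :=
    fun M => (Real.summable_pow_div_factorial M).mul_left C
  have hYsum : ∀ z, HasSum (fun n => u n z) (∑' n, u n z) := by
    intro z
    obtain ⟨M, -, hM⟩ := hloc |z|
    exact (Summable.of_norm_bounded (hsumm M)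
      fun n => hM n z ⟨neg_abs_le z, le_abs_self z⟩).hasSum
  refine ⟨fun z => ∑' n, u n z, ?_, fun z => ?_⟩
  · rw [continuous_iff_continuousAt]
    intro z
    obtain ⟨M, -, hM⟩ := hloc (|z| + 1)
    have hc : ContinuousOn (fun z => ∑' n, u n z) (Icc (-(|z| + 1)) (|z| + 1)) :=
      continuousOn_tsum (fun n => (huc n).continuousOn) (hsumm M) hM
    refine hc.continuousAt (Icc_mem_nhds ?_ ?_)
    · linarith [neg_abs_le z]
    · linarith [le_abs_self z]
  · obtain ⟨M, hM0, hM⟩ := hloc |z|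
    have hsub : ∀ t ∈ uIoc 0 z, t ∈ Icc (-|z|) |z| := by
      intro t ht
      have h := uIoc_subset_uIcc ht
      rcases le_total 0 z with hz | hz
      · rw [uIcc_of_le hz] at h
        rw [abs_of_nonneg hz]
        exact ⟨by linarith [h.1], h.2⟩
      · rw [uIcc_of_ge hz] at h
        rw [abs_of_nonpos hz]
        exact ⟨by linarith [h.1], by linarith [h.2]⟩
    have hint : HasSum (fun n => ∫ t in (0 : ℝ)..z, A t * u n t)
        (∫ t in (0 : ℝ)..z, A t * ∑' n, u n t) := by
      refine intervalIntegral.hasSum_integral_of_dominated_convergence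
        (fun n t => a t * (C * (M ^ n / n.factorial))) (fun n => ?_) (fun n => ?_) ?_ ?_ ?_
      · exact (hmul _ (huc n) 0 z).def'.aestronglyMeasurable
      · exact Eventually.of_forall fun t ht => (norm_mul_le _ _).trans
          (mul_le_mul_of_nonneg_left (hM n t (hsub t ht)) (norm_nonneg _))
      · exact Eventually.of_forall fun t _ => (hsumm M).mul_left _
      · simp_rw [tsum_mul_left]
        exact (ha 0 z).mul_const _
      · exact Eventually.of_forall fun t _ => (hYsum t).mul_left _
    have h1 : HasSum (fun n => u (n + 1) z) (∫ t in (0 : ℝ)..z, A t * ∑' n, u n t) := hint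
    have h2 := (hYsum z).summable.tsum_eq_zero_add
    rw [h1.tsum_eq, hu0] at h2
    exact h2

theorem absolutelyContinuous_primitive {E : Type*} [NormedAddCommGroup E] [NormedSpace ℝ E]
    (f : ℝ → E) (hf : ∀ x y, IntervalIntegrable f MeasureTheory.volume x y) (x y : ℝ) :
    AbsolutelyContinuousOnInterval (fun z => ∫ t in (0 : ℝ)..z, f t) x y := by
  have hn : ∀ x y, IntervalIntegrable (fun t => ‖f t‖) MeasureTheory.volume x y :=
    fun x y => (hf x y).norm
  have hG : AbsolutelyContinuousOnInterval (fun z => ∫ t in x..z, ‖f t‖) x y :=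
    (hn x y).absolutelyContinuousOnInterval_intervalIntegral (by simp)
  refine squeeze_zero (fun e => Finset.sum_nonneg fun i _ => dist_nonneg) (fun e => ?_) hG
  refine Finset.sum_le_sum fun i _ => ?_
  rw [dist_eq_norm, dist_eq_norm, intervalIntegral.integral_interval_sub_left (hf _ _) (hf _ _),
    intervalIntegral.integral_interval_sub_left (hn _ _) (hn _ _), Real.norm_eq_abs]
  exact intervalIntegral.norm_integral_le_abs_integral_norm

/-! ### The system `J Y' + Q Y = λ Y` -/

/-- The symplectic matrix `J`. -/
def J : Matrix (Fin 2) (Fin 2) ℂ := !![0, 1; -1, 0]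

/-- The Pauli matrix `σ₁`. -/
def sigma1 : Matrix (Fin 2) (Fin 2) ℂ := !![0, 1; 1, 0]

/-- The Pauli matrix `σ₂`, with the sign convention `σ₂ = i J`. -/
def sigma2 : Matrix (Fin 2) (Fin 2) ℂ := !![0, Complex.I; -Complex.I, 0]

/-- The Pauli matrix `σ₃`. -/
def sigma3 : Matrix (Fin 2) (Fin 2) ℂ := !![1, 0; 0, -1]

/-- `Y` is the matrix solution on `ℝ` of `J Y' + Q Y = lam Y` with `Y 0 = 𝕀`, in the sense of
Carathéodory: its entries are absolutely continuous on every compact interval and the equation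
holds almost everywhere. -/
structure IsFundamentalMatrix (Q : ℝ → Matrix (Fin 2) (Fin 2) ℂ) (lam : ℂ)
    (Y : ℝ → Matrix (Fin 2) (Fin 2) ℂ) : Prop where
  absolutelyContinuous : ∀ (i j : Fin 2) (a b : ℝ),
    AbsolutelyContinuousOnInterval (fun z => Y z i j) a b
  equation : ∀ᵐ z : ℝ, ∃ Y' : Matrix (Fin 2) (Fin 2) ℂ,
    (∀ i j, HasDerivAt (fun t => Y t i j) (Y' i j) z) ∧ J * Y' + Q z * Y z = lam • Y z
  initial : Y 0 = 1

section
open MeasureTheory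

theorem exists_isFundamentalMatrix (Q : ℝ → Matrix (Fin 2) (Fin 2) ℂ)
    (hper : Function.Periodic Q Real.pi)
    (hint : ∀ i j, IntegrableOn (fun z => Q z i j) (Set.Ico 0 Real.pi)) (lam : ℂ) :
    ∃ Y, IsFundamentalMatrix Q lam Y := by
  have hQij : ∀ i j x y, IntervalIntegrable (fun z => Q z i j) volume x y := by
    intro i j x y
    have hp : Function.Periodic (fun z => Q z i j) Real.pi := fun z => by simp only [hper z]
    refine hp.intervalIntegrable₀ Real.pi_ne_zero ?_ x y
    rw [intervalIntegrable_iff_integrableOn_Ico_of_le Real.pi_pos.le]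
    exact hint i j
  set A : ℝ → Matrix (Fin 2) (Fin 2) ℂ := fun z => J * (Q z - lam • 1) with hAdef
  have hAij : ∀ i j x y, IntervalIntegrable (fun z => A z i j) volume x y := by
    intro i j x y
    have h : (fun z => A z i j) = fun z => J i 0 * (Q z 0 j - (lam • (1 : Matrix (Fin 2) (Fin 2) ℂ)) 0 j)
        + J i 1 * (Q z 1 j - (lam • (1 : Matrix (Fin 2) (Fin 2) ℂ)) 1 j) := by
      funext z
      simp [hAdef, Matrix.mul_apply, Fin.sum_univ_two]
    rw [h]
    exact (((hQij 0 j x y).sub intervalIntegrable_const).const_mul _).add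
      (((hQij 1 j x y).sub intervalIntegrable_const).const_mul _)
  -- Matrices are viewed as operators on `ℂ²`, in order to have a complete normed algebra.
  let m : Matrix (Fin 2) (Fin 2) ℂ → ((Fin 2 → ℂ) →L[ℂ] (Fin 2 → ℂ)) := fun M =>
    LinearMap.toContinuousLinearMap (Matrix.toLin' M)
  have hmA : ∀ x y, IntervalIntegrable (fun z => m (A z)) volume x y := by
    intro x y
    have h : (fun z => m (A z)) = fun z => ∑ i, ∑ j, (A z i j) • m (Matrix.single i j 1) := by
      funext z
      conv_lhs => rw [Matrix.matrix_eq_sum_single (A z)]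
      simp only [m, map_sum, ← map_smul, Matrix.smul_single, smul_eq_mul, mul_one]
    rw [h]
    have h2 : ∀ i j : Fin 2, IntervalIntegrable
        (fun z => (A z i j) • m (Matrix.single i j (1 : ℂ))) volume x y :=
      fun i j => ⟨(hAij i j x y).1.smul_const _, (hAij i j x y).2.smul_const _⟩
    simp only [Fin.sum_univ_two]
    exact ((h2 0 0).add (h2 0 1)).add ((h2 1 0).add (h2 1 1))
  obtain ⟨T, hTc, hT⟩ := exists_volterra (fun z => m (A z)) hmA
  have hAT : ∀ x y, IntervalIntegrable (fun t => m (A t) * T t) volume x y :=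
    fun x y => (hmA x y).mul_continuousOn hTc.continuousOn
  let L : Fin 2 → Fin 2 → ((Fin 2 → ℂ) →L[ℂ] (Fin 2 → ℂ)) →L[ℂ] ℂ := fun i j =>
    (ContinuousLinearMap.proj i).comp (ContinuousLinearMap.apply ℂ (Fin 2 → ℂ) (Pi.single j 1))
  let Y : ℝ → Matrix (Fin 2) (Fin 2) ℂ := fun z => LinearMap.toMatrix' (T z : (Fin 2 → ℂ) →ₗ[ℂ] _)
  have hLY : ∀ i j z, L i j (T z) = Y z i j := by
    intro i j z
    simp [L, Y, LinearMap.toMatrix'_apply]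
  have hLAT : ∀ i j z, L i j (m (A z) * T z) = (A z * Y z) i j := by
    intro i j z
    have : A z * Y z = LinearMap.toMatrix' ((m (A z) * T z : _ →L[ℂ] _) : (Fin 2 → ℂ) →ₗ[ℂ] _) := by
      change _ = LinearMap.toMatrix' ((Matrix.toLin' (A z)) ∘ₗ (T z : (Fin 2 → ℂ) →ₗ[ℂ] _))
      rw [LinearMap.toMatrix'_comp, LinearMap.toMatrix'_toLin']
    rw [this]
    simp [L, LinearMap.toMatrix'_apply]
  have hfint : ∀ i j x y, IntervalIntegrable (fun t => (A t * Y t) i j) volume x y := by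
    intro i j x y
    simp_rw [← hLAT]
    exact ⟨(L i j).integrable_comp (hAT x y).1, (L i j).integrable_comp (hAT x y).2⟩
  have hentry : ∀ i j, (fun z => Y z i j)
      = fun z => (1 : Matrix (Fin 2) (Fin 2) ℂ) i j + ∫ t in (0 : ℝ)..z, (A t * Y t) i j := by
    intro i j
    funext z
    have h := (L i j).intervalIntegral_comp_comm (hAT 0 z)
    simp only [hLAT] at h
    rw [h, ← hLY, hT z, map_add]
    congr 1
    simp [L, Matrix.one_apply, Pi.single_apply]
  refine ⟨Y, ⟨fun i j a b => ?_, ?_, ?_⟩⟩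
  · rw [hentry i j]
    refine AbsolutelyContinuousOnInterval.fun_add ?_ (absolutelyContinuous_primitive _ (hfint i j) a b)
    exact (LipschitzWith.const' (K := 0) _).lipschitzOnWith.absolutelyContinuousOnInterval
  · have hd : ∀ i j, ∀ᵐ z : ℝ, HasDerivAt (fun t => Y t i j) ((A z * Y z) i j) z := by
      intro i j
      have hloc : LocallyIntegrable (fun t => (A t * Y t) i j) volume := by
        rw [locallyIntegrable_iff]
        intro K hK
        obtain ⟨r, hr⟩ := hK.isBounded.subset_closedBall 0
        have : K ⊆ Set.Icc (-r) r := by simpa [Real.closedBall_eq_Icc] using hr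
        rcases le_or_gt (-r) r with h | h
        · refine IntegrableOn.mono_set ?_ this
          rw [integrableOn_Icc_iff_integrableOn_Ioc,
            ← intervalIntegrable_iff_integrableOn_Ioc_of_le h]
          exact hfint i j _ _
        · rw [Set.Icc_eq_empty (not_le.mpr h), Set.subset_empty_iff] at this
          simp [this]
      filter_upwards [LocallyIntegrable.ae_hasDerivAt_integral hloc] with z hz
      rw [hentry i j]
      exact (hz 0).const_add _
    have hall : ∀ᵐ z : ℝ, ∀ i j, HasDerivAt (fun t => Y t i j) ((A z * Y z) i j) z :=
      ae_all_iff.mpr fun i => ae_all_iff.mpr fun j => hd i j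
    filter_upwards [hall] with z hz
    refine ⟨A z * Y z, hz, ?_⟩
    have hJ : J * J = -1 := by
      ext i j; fin_cases i <;> fin_cases j <;> simp [J, Matrix.mul_apply]
    rw [hAdef]
    simp only
    rw [← mul_assoc, ← mul_assoc, hJ]
    simp [sub_mul]
  · ext i j
    have := congrFun (hentry i j) 0
    simpa using this

end

/-- The fundamental matrix `𝕐(z)` of `J Y' + Q Y = lam Y`, normalised by `𝕐(0) = 𝕀`. For periodic
locally integrable `Q` it exists by `exists_isFundamentalMatrix`, and it is the only one, since the
initial value problem is linear with locally integrable coefficients. -/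
noncomputable def fundamentalMatrix (Q : ℝ → Matrix (Fin 2) (Fin 2) ℂ) (lam : ℂ) :
    ℝ → Matrix (Fin 2) (Fin 2) ℂ :=
  Classical.epsilon (IsFundamentalMatrix Q lam)

theorem isFundamentalMatrix_fundamentalMatrix (Q : ℝ → Matrix (Fin 2) (Fin 2) ℂ)
    (hper : Function.Periodic Q Real.pi)
    (hint : ∀ i j, MeasureTheory.IntegrableOn (fun z => Q z i j) (Set.Ico 0 Real.pi)) (lam : ℂ) :
    IsFundamentalMatrix Q lam (fundamentalMatrix Q lam) :=
  Classical.epsilon_spec (exists_isFundamentalMatrix Q hper hint lam)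

/-- The discriminant `Δ(lam) = y₁₁(π) + y₂₂(π)`, the trace of `𝕐(π)`. -/
noncomputable def discriminant (Q : ℝ → Matrix (Fin 2) (Fin 2) ℂ) (lam : ℂ) : ℂ :=
  (fundamentalMatrix Q lam Real.pi).trace

/-- Every zero of `f` is a zero of order exactly two (in particular `f` is analytic there). -/
def OnlyDoubleZeros (f : ℂ → ℂ) : Prop :=
  ∀ lam : ℂ, f lam = 0 → analyticOrderAt f lam = 2

/-! ### The `J`-decomposition of the potential and the gauge transformation

Throughout `Q = !![q₁, q; q*, q₂]`, so that `q₁ = Q 0 0`, `q = Q 0 1` and `q₂ = Q 1 1`. -/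

/-- The part `Q₁ = Re(q) σ₁ + ½ (q₁ - q₂) σ₃` of `Q`, which anticommutes with `J`. -/
noncomputable def Q1 (Q : ℝ → Matrix (Fin 2) (Fin 2) ℂ) (z : ℝ) : Matrix (Fin 2) (Fin 2) ℂ :=
  ((Q z 0 1).re : ℂ) • sigma1 + ((Q z 0 0 - Q z 1 1) / 2) • sigma3

/-- The part `Q₂ = ½ (q₁ + q₂) σ₀ + Im(q) σ₂` of `Q`, which commutes with `J`. -/
noncomputable def Q2 (Q : ℝ → Matrix (Fin 2) (Fin 2) ℂ) (z : ℝ) : Matrix (Fin 2) (Fin 2) ℂ :=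
  ((Q z 0 0 + Q z 1 1) / 2) • (1 : Matrix (Fin 2) (Fin 2) ℂ) + ((Q z 0 1).im : ℂ) • sigma2

/-- The entrywise integral of a matrix function over `[a, b]`. -/
noncomputable def matrixIntegral (M : ℝ → Matrix (Fin 2) (Fin 2) ℂ) (a b : ℝ) :
    Matrix (Fin 2) (Fin 2) ℂ :=
  Matrix.of fun i j => ∫ t in a..b, M t i j

/-- The mean value `π⁻¹ ∫₀^π Q₂`. -/
noncomputable def meanQ2 (Q : ℝ → Matrix (Fin 2) (Fin 2) ℂ) : Matrix (Fin 2) (Fin 2) ℂ :=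
  (1 / (Real.pi : ℂ)) • matrixIntegral (Q2 Q) 0 Real.pi

/-- The gauge matrix `R(z) = exp (J ∫₀^z (Q₂ - π⁻¹ ∫₀^π Q₂))`. -/
noncomputable def gaugeMatrix (Q : ℝ → Matrix (Fin 2) (Fin 2) ℂ) (z : ℝ) : Matrix (Fin 2) (Fin 2) ℂ :=
  NormedSpace.exp (J * matrixIntegral (fun t => Q2 Q t - meanQ2 Q) 0 z)

/-- The transformed potential `Q̃ = Q̃₁ + Q̃₂` with `Q̃₁ = R⁻¹ Q₁ R` and `Q̃₂ = π⁻¹ ∫₀^π Q₂`. -/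
noncomputable def transformedPotential (Q : ℝ → Matrix (Fin 2) (Fin 2) ℂ) (z : ℝ) :
    Matrix (Fin 2) (Fin 2) ℂ :=
  (gaugeMatrix Q z)⁻¹ * Q1 Q z * gaugeMatrix Q z + meanQ2 Q

/-- The unimodular constant `exp (-i ∫₀^π Im q)`. -/
noncomputable def phase (Q : ℝ → Matrix (Fin 2) (Fin 2) ℂ) : ℂ :=
  Complex.exp (-Complex.I * ((∫ t in (0 : ℝ)..Real.pi, (Q t 0 1).im : ℝ) : ℂ))

end DiracSystem

/-! A gauge transformation, which shifts `lam` by the mean of `½ (q₁ + q₂)` and multiplies `Δ` by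
a constant phase, reduces the system to one whose potential `P` anticommutes with `J`. Let
`A(lam)` and `B(lam)` be its transfer matrices over `[0, π/2]` and `[π/2, π]`; they have
determinant one and the discriminant is `tr (B A)`.

If `P` has period `π/2`, then `A = B` and `tr (A²) + 2 = (tr A)²`. For the self-adjoint system a
critical point of `tr A` with `tr A ∈ [-2, 2]` forces `A` to be scalar, which `tr A = 0` and `det
A = 1` exclude; so the zeros of `tr A` are simple.

Conversely, at a double zero of `tr (B A) + 2` the same fact gives `B A = -1`, so `A - B` is
scalar there. Each linear functional of `A - B` that kills the identity is thus an entire function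
vanishing at all zeros of `tr (B A) + 2`. The square of this function divided by `tr (B A) + 2` is
entire, and it tends to `0` on the circles `|lam| = 2 k`: the denominator grows like `exp (π |Im
lam|)` there, whereas `A - B = o(exp (π |Im lam| / 2))` by the Riemann–Lebesgue lemma. So `A - B`
is scalar for every `lam`; as the determinants agree, `A = B` or `B A = -1`, and the latter would
make the denominator vanish.

Finally `A = B` for all `lam` forces `P(t) = P(t + π/2)` on `[0, π/2]`: the quotient of the
transfer matrices of these two potentials over `[0, x]` is an entire function of `lam` that tends
to `1` on the circles, so it is `1`. -/

namespace DiracSystem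

section Calculus
open MeasureTheory Set Filter

theorem locallyIntegrable_of_intervalIntegrable {E : Type*} [NormedAddCommGroup E] {f : ℝ → E}
    (hf : ∀ x y, IntervalIntegrable f volume x y) : LocallyIntegrable f volume := fun x =>
  ⟨Ioo (x - 1) (x + 1), Ioo_mem_nhds (by linarith) (by linarith),
    ((intervalIntegrable_iff_integrableOn_Ioc_of_le (by linarith)).1
      (hf (x - 1) (x + 1))).mono_set Ioo_subset_Ioc_self⟩

theorem absolutelyContinuous_comp_of_lipschitzOnWith {X Y : Type*} [PseudoMetricSpace X]
    [PseudoMetricSpace Y] {g : X → Y} {K : NNReal} {s : Set X} {F : ℝ → X} {a b : ℝ}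
    (hg : LipschitzOnWith K g s) (hs : MapsTo F (uIcc a b) s)
    (hF : AbsolutelyContinuousOnInterval F a b) :
    AbsolutelyContinuousOnInterval (g ∘ F) a b := by
  refine squeeze_zero' (Eventually.of_forall fun _ => Finset.sum_nonneg fun _ _ => dist_nonneg) ?_
    (by simpa using Tendsto.const_mul (K : ℝ) hF)
  rw [eventually_inf_principal]
  filter_upwards with p hp
  rw [Finset.mul_sum]
  exact Finset.sum_le_sum fun i hi =>
    hg.dist_le_mul _ (hs (hp.1 i hi).1) _ (hs (hp.1 i hi).2)

theorem absolutelyContinuous_mul {A : Type*} [NormedRing A] {F G : ℝ → A} {a b : ℝ}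
    (hF : AbsolutelyContinuousOnInterval F a b) (hG : AbsolutelyContinuousOnInterval G a b) :
    AbsolutelyContinuousOnInterval (fun x => F x * G x) a b := by
  obtain ⟨C, hC⟩ := hF.exists_bound
  obtain ⟨D, hD⟩ := hG.exists_bound
  refine squeeze_zero' (Eventually.of_forall fun _ => Finset.sum_nonneg fun i _ => dist_nonneg) ?_
    (by simpa using Tendsto.add (Tendsto.const_mul C hG) (Tendsto.const_mul D hF))
  rw [eventually_inf_principal]
  filter_upwards with p hp
  rw [Finset.mul_sum, Finset.mul_sum, ← Finset.sum_add_distrib]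
  refine Finset.sum_le_sum fun i hi => ?_
  simp only [dist_eq_norm]
  have hF' := hC _ (hp.1 i hi).1
  have hG' := hD _ (hp.1 i hi).2
  calc ‖F (p.2 i).1 * G (p.2 i).1 - F (p.2 i).2 * G (p.2 i).2‖
      = ‖F (p.2 i).1 * (G (p.2 i).1 - G (p.2 i).2)
          + (F (p.2 i).1 - F (p.2 i).2) * G (p.2 i).2‖ := by congr 1; noncomm_ring
    _ ≤ ‖F (p.2 i).1‖ * ‖G (p.2 i).1 - G (p.2 i).2‖
        + ‖F (p.2 i).1 - F (p.2 i).2‖ * ‖G (p.2 i).2‖ :=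
      (norm_add_le _ _).trans (add_le_add (norm_mul_le _ _) (norm_mul_le _ _))
    _ ≤ C * ‖G (p.2 i).1 - G (p.2 i).2‖ + D * ‖F (p.2 i).1 - F (p.2 i).2‖ := by
      rw [mul_comm D]
      gcongr

variable {E : Type*} [NormedAddCommGroup E] [NormedSpace ℝ E]

/-- `F` is a locally absolutely continuous function on the line with derivative `f` almost
everywhere, encoded by the integral equation so that solutions of linear equations with merely
locally integrable coefficients are covered. -/
structure IsPrimitive (F f : ℝ → E) : Prop where
  intervalIntegrable : ∀ x y, IntervalIntegrable f volume x y
  eq_integral : ∀ x, F x = F 0 + ∫ t in (0 : ℝ)..x, f t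

namespace IsPrimitive

variable {F G f g : ℝ → E}

theorem integral (hf : ∀ x y, IntervalIntegrable f volume x y) :
    IsPrimitive (fun x => ∫ t in (0 : ℝ)..x, f t) f :=
  ⟨hf, fun x => by simp⟩

theorem sub_eq_integral (hF : IsPrimitive F f) (x y : ℝ) :
    F y - F x = ∫ t in x..y, f t := by
  rw [hF.eq_integral x, hF.eq_integral y, add_sub_add_left_eq_sub,
    intervalIntegral.integral_interval_sub_left (hF.intervalIntegrable _ _)
      (hF.intervalIntegrable _ _)]

theorem continuous (hF : IsPrimitive F f) : Continuous F := by
  rw [funext hF.eq_integral]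
  exact continuous_const.add (intervalIntegral.continuous_primitive hF.intervalIntegrable 0)

theorem congr (hF : IsPrimitive F f) (hfg : f =ᵐ[volume] g) : IsPrimitive F g where
  intervalIntegrable x y := (hF.intervalIntegrable x y).congr_ae (ae_restrict_of_ae hfg)
  eq_integral x := by
    rw [hF.eq_integral x, intervalIntegral.integral_congr_ae (hfg.mono fun t ht _ => ht)]

theorem const (c : E) : IsPrimitive (fun _ => c) (fun _ => (0 : E)) :=
  ⟨fun _ _ => intervalIntegrable_const, fun _ => by simp⟩

theorem eq_of_zero (hF : IsPrimitive F (fun _ => 0)) (x : ℝ) : F x = F 0 := by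
  simpa using hF.eq_integral x

theorem add (hF : IsPrimitive F f) (hG : IsPrimitive G g) :
    IsPrimitive (fun x => F x + G x) (fun x => f x + g x) where
  intervalIntegrable x y := (hF.intervalIntegrable x y).add (hG.intervalIntegrable x y)
  eq_integral x := by
    rw [intervalIntegral.integral_add (hF.intervalIntegrable _ _) (hG.intervalIntegrable _ _),
      hF.eq_integral x, hG.eq_integral x]
    abel

theorem sub (hF : IsPrimitive F f) (hG : IsPrimitive G g) :
    IsPrimitive (fun x => F x - G x) (fun x => f x - g x) where
  intervalIntegrable x y := (hF.intervalIntegrable x y).sub (hG.intervalIntegrable x y)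
  eq_integral x := by
    rw [intervalIntegral.integral_sub (hF.intervalIntegrable _ _) (hG.intervalIntegrable _ _),
      hF.eq_integral x, hG.eq_integral x]
    abel

theorem comp_const_add (hF : IsPrimitive F f) (s : ℝ) :
    IsPrimitive (fun x => F (s + x)) (fun x => f (s + x)) where
  intervalIntegrable x y := by
    simpa using (hF.intervalIntegrable (s + x) (s + y)).comp_add_left s
  eq_integral x := by
    rw [intervalIntegral.integral_comp_add_left, ← hF.sub_eq_integral]
    abel

theorem absolutelyContinuous (hF : IsPrimitive F f) (x y : ℝ) :
    AbsolutelyContinuousOnInterval F x y := by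
  rw [funext hF.eq_integral]
  exact (LipschitzOnWith.absolutelyContinuousOnInterval (LipschitzWith.const' (K := 0)
    (F 0)).lipschitzOnWith).fun_add (absolutelyContinuous_primitive f hF.intervalIntegrable x y)

variable [CompleteSpace E]

theorem clm {E' : Type*} [NormedAddCommGroup E'] [NormedSpace ℝ E'] [CompleteSpace E']
    (hF : IsPrimitive F f) (L : E →L[ℝ] E') :
    IsPrimitive (fun x => L (F x)) (fun x => L (f x)) where
  intervalIntegrable x y := ⟨L.integrable_comp (hF.intervalIntegrable x y).1,
    L.integrable_comp (hF.intervalIntegrable x y).2⟩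
  eq_integral x := by
    rw [L.intervalIntegral_comp_comm (hF.intervalIntegrable 0 x), hF.eq_integral x, map_add]

theorem of_hasDerivAt (hF : ∀ x, HasDerivAt F (f x) x) (hf : Continuous f) : IsPrimitive F f where
  intervalIntegrable x y := hf.intervalIntegrable x y
  eq_integral x := by
    rw [intervalIntegral.integral_eq_sub_of_hasDerivAt (fun t _ => hF t)
      (hf.intervalIntegrable 0 x)]
    abel

theorem ae_hasDerivAt (hF : IsPrimitive F f) : ∀ᵐ x, HasDerivAt F (f x) x := by
  filter_upwards [LocallyIntegrable.ae_hasDerivAt_integral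
    (locallyIntegrable_of_intervalIntegrable hF.intervalIntegrable)] with x hx
  rw [funext hF.eq_integral]
  exact (hx 0).const_add _

theorem of_absolutelyContinuous (hf : ∀ x y, IntervalIntegrable f volume x y)
    (hF : ∀ x y, AbsolutelyContinuousOnInterval F x y) (hd : ∀ᵐ x, HasDerivAt F (f x) x) :
    IsPrimitive F f where
  intervalIntegrable := hf
  eq_integral x := by
    obtain ⟨C, hC⟩ := ((hF 0 x).fun_sub
      ((integral hf).absolutelyContinuous 0 x)).const_of_ae_hasDerivAt_zero (by
        filter_upwards [hd, (integral hf).ae_hasDerivAt] with t h₁ h₂ _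
        simpa using h₁.fun_sub h₂)
    have h₀ := hC 0 left_mem_uIcc
    have hx := hC x right_mem_uIcc
    simp only [intervalIntegral.integral_same, sub_zero] at h₀
    rw [h₀, ← hx]
    abel

theorem mul {A : Type*} [NormedRing A] [NormedAlgebra ℝ A] [CompleteSpace A] {F G f g : ℝ → A}
    (hF : IsPrimitive F f) (hG : IsPrimitive G g) :
    IsPrimitive (fun x => F x * G x) (fun x => f x * G x + F x * g x) :=
  of_absolutelyContinuous
    (fun x y => ((hF.intervalIntegrable x y).mul_continuousOn hG.continuous.continuousOn).add
      ((hG.intervalIntegrable x y).continuousOn_mul hF.continuous.continuousOn))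
    (fun x y =>
      absolutelyContinuous_mul (hF.absolutelyContinuous x y) (hG.absolutelyContinuous x y))
    (by filter_upwards [hF.ae_hasDerivAt, hG.ae_hasDerivAt] with x h₁ h₂ using h₁.mul h₂)

theorem comp {α a : ℝ → ℝ} (hα : IsPrimitive α a) (hF : ∀ x, HasDerivAt F (f x) x)
    (hf : Continuous f) : IsPrimitive (fun t => F (α t)) (fun t => a t • f (α t)) := by
  refine of_absolutelyContinuous
    (fun x y => (hα.intervalIntegrable x y).smul_continuousOn
      (hf.comp hα.continuous).continuousOn) (fun x y => ?_)
    (by filter_upwards [hα.ae_hasDerivAt] with t ht using (hF (α t)).scomp t ht)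
  obtain ⟨r, hr⟩ := (hα.absolutelyContinuous x y).exists_bound
  obtain ⟨K, hK⟩ := (isCompact_Icc (a := -r) (b := r)).exists_bound_of_continuousOn
    hf.continuousOn
  have hLip : LipschitzOnWith K.toNNReal F (Icc (-r) r) :=
    (convex_Icc _ _).lipschitzOnWith_of_nnnorm_hasDerivWithin_le
      (fun z _ => (hF z).hasDerivWithinAt) fun z hz => by
        rw [← NNReal.coe_le_coe, coe_nnnorm]
        exact (hK z hz).trans (le_max_left _ _)
  exact absolutelyContinuous_comp_of_lipschitzOnWith hLip (fun t ht => abs_le.1 (hr t ht))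
    (hα.absolutelyContinuous x y)

end IsPrimitive

theorem le_mul_exp_of_le_add_integral {a u : ℝ → ℝ} (ha : ∀ x y, IntervalIntegrable a volume x y)
    (ha0 : ∀ t, 0 ≤ a t) (hu : Continuous u) {c X : ℝ} (hX : 0 ≤ X)
    (h : ∀ x ∈ Icc 0 X, u x ≤ c + ∫ t in (0 : ℝ)..x, a t * u t) :
    u X ≤ c * Real.exp (∫ t in (0 : ℝ)..X, a t) := by
  set α : ℝ → ℝ := fun x => ∫ t in (0 : ℝ)..x, a t
  set U : ℝ → ℝ := fun x => c + ∫ t in (0 : ℝ)..x, a t * u t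
  have hα : IsPrimitive α a := .integral ha
  have hU : IsPrimitive U fun t => a t * u t := by
    simpa only [zero_add] using (IsPrimitive.const c).add
      (.integral fun x y => (ha x y).mul_continuousOn hu.continuousOn)
  have hexp : IsPrimitive (fun x => Real.exp (-α x)) fun t => a t • -Real.exp (-α t) :=
    hα.comp (F := fun y => Real.exp (-y)) (f := fun y => -Real.exp (-y))
      (fun y => by simpa using (hasDerivAt_neg y).exp) (by fun_prop)
  have hmono : U X * Real.exp (-α X) ≤ c := by
    rw [(hU.mul hexp).eq_integral X]
    have hneg : ∫ t in (0 : ℝ)..X, (a t * u t * Real.exp (-α t) + U t * (a t • -Real.exp (-α t)))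
        ≤ ∫ _ in (0 : ℝ)..X, (0 : ℝ) := by
      refine intervalIntegral.integral_mono_on hX ((hU.mul hexp).intervalIntegrable 0 X)
        intervalIntegrable_const fun t ht => ?_
      have := mul_nonneg (mul_nonneg (ha0 t) (Real.exp_nonneg (-α t))) (sub_nonneg.2 (h t ht))
      rw [smul_eq_mul]
      linarith
    simpa [U, α] using hneg
  calc u X ≤ U X := h X ⟨hX, le_rfl⟩
    _ = U X * Real.exp (-α X) * Real.exp (α X) := by rw [mul_assoc, ← Real.exp_add]; simp
    _ ≤ c * Real.exp (α X) := by gcongr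

theorem ae_eq_translate_of_periodic {X : Type*} {f : ℝ → X} {h : ℝ} (hh : 0 < h)
    (hf : Function.Periodic f (h + h)) (hfh : ∀ᵐ t, t ∈ Ioo 0 h → f t = f (h + t)) :
    ∀ᵐ t, f (t + h) = f t := by
  have hP : Function.Periodic (fun t => f (t + h) = f t) h := by
    intro t
    simp only [add_assoc t h h, hf t, eq_iff_iff]
    exact eq_comm
  have hIco : ∀ᵐ t, t ∈ Ico 0 h → f (t + h) = f t := by
    filter_upwards [hfh, compl_mem_ae_iff.2 (Real.volume_singleton (a := 0))] with t ht h0 hI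
    rw [ht ⟨lt_of_le_of_ne hI.1 (Ne.symm h0), hI.2⟩, add_comm]
  have htranslates : ∀ᵐ t, ∀ k : ℤ, t - k * h ∈ Ico 0 h → f (t - k * h + h) = f (t - k * h) :=
    ae_all_iff.2 fun k =>
      (measurePreserving_sub_right volume ((k : ℝ) * h)).quasiMeasurePreserving.ae hIco
  filter_upwards [htranslates] with t ht
  refine (hP.sub_int_mul_eq (x := t) ⌊t / h⌋).mp (ht ⌊t / h⌋ ⟨?_, ?_⟩)
  · exact sub_nonneg.2 ((le_div_iff₀ hh).1 (Int.floor_le _))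
  · rw [sub_lt_iff_lt_add', ← add_one_mul]
    exact (div_lt_iff₀ hh).1 (Int.lt_floor_add_one _)

end Calculus

section LinearEquation
open MeasureTheory Set Filter

theorem monotoneOn_integral_norm {E : Type*} [NormedAddCommGroup E] {f : ℝ → E}
    (hf : ∀ x y, IntervalIntegrable f volume x y) :
    MonotoneOn (fun x => ∫ t in (0 : ℝ)..x, ‖f t‖) (Ici 0) :=
  fun _ hx y _ hxy => intervalIntegral.integral_mono_interval le_rfl hx hxy
    (Eventually.of_forall fun _ => norm_nonneg _) (hf 0 y).norm

theorem norm_integral_mul_le {E : Type*} [NormedRing E] [NormedAlgebra ℝ E] {f g : ℝ → E}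
    (hf : ∀ x y, IntervalIntegrable f volume x y) {K x : ℝ} (hx : 0 ≤ x)
    (hg : ∀ t ∈ Icc 0 x, ‖g t‖ ≤ K) :
    ‖∫ t in (0 : ℝ)..x, f t * g t‖ ≤ (∫ t in (0 : ℝ)..x, ‖f t‖) * K := by
  rw [← intervalIntegral.integral_mul_const]
  refine intervalIntegral.norm_integral_le_of_norm_le hx (Eventually.of_forall fun t ht => ?_)
    ((hf 0 x).norm.mul_const K)
  exact (norm_mul_le _ _).trans (by gcongr; exact hg t ⟨ht.1.le, ht.2⟩)

variable {E : Type*} [NormedRing E] [NormedAlgebra ℝ E] [CompleteSpace E]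

theorem exists_isPrimitive_coeff_mul {A : ℝ → E} (hA : ∀ x y, IntervalIntegrable A volume x y) :
    ∃ Y : ℝ → E, Y 0 = 1 ∧ IsPrimitive Y (fun t => A t * Y t) := by
  obtain ⟨Y, hYc, hY⟩ := exists_volterra A hA
  have h0 : Y 0 = 1 := by simpa using hY 0
  exact ⟨Y, h0, fun x y => (hA x y).mul_continuousOn hYc.continuousOn, fun x => by rw [h0, hY x]⟩

theorem exists_isPrimitive_mul_coeff {A : ℝ → E} (hA : ∀ x y, IntervalIntegrable A volume x y) :
    ∃ Y : ℝ → E, Y 0 = 1 ∧ IsPrimitive Y (fun t => Y t * A t) := by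
  let op : E ≃L[ℝ] Eᵐᵒᵖ := MulOpposite.opContinuousLinearEquiv ℝ
  obtain ⟨Z, hZ0, hZ⟩ := exists_isPrimitive_coeff_mul (A := fun t => op (A t))
    ((IsPrimitive.integral hA).clm op.toContinuousLinearMap).intervalIntegrable
  exact ⟨fun t => op.symm (Z t), by simp [hZ0, op], hZ.clm op.symm.toContinuousLinearMap⟩

/-- The fundamental solution of `Y' = A Y` normalized by `Y 0 = 1`. It is unique, and `A` is assumed
locally integrable wherever it is used. -/
noncomputable def propagator (A : ℝ → E) : ℝ → E :=
  Classical.epsilon fun Y => Y 0 = 1 ∧ IsPrimitive Y (fun t => A t * Y t)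

variable {A : ℝ → E} (hA : ∀ x y, IntervalIntegrable A volume x y)
include hA

theorem propagator_zero : propagator A 0 = 1 :=
  (Classical.epsilon_spec (exists_isPrimitive_coeff_mul hA)).1

theorem isPrimitive_propagator : IsPrimitive (propagator A) (fun t => A t * propagator A t) :=
  (Classical.epsilon_spec (exists_isPrimitive_coeff_mul hA)).2

theorem continuous_propagator : Continuous (propagator A) :=
  (isPrimitive_propagator hA).continuous

theorem norm_propagator_le {x : ℝ} (hx : 0 ≤ x) :
    ‖propagator A x‖ ≤ ‖(1 : E)‖ * Real.exp (∫ t in (0 : ℝ)..x, ‖A t‖) := by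
  refine le_mul_exp_of_le_add_integral (fun x y => (hA x y).norm) (fun _ => norm_nonneg _)
    (continuous_propagator hA).norm hx fun y hy => ?_
  rw [(isPrimitive_propagator hA).eq_integral y, propagator_zero hA]
  refine (norm_add_le _ _).trans (add_le_add le_rfl ?_)
  exact intervalIntegral.norm_integral_le_of_norm_le hy.1
    (Eventually.of_forall fun t _ => norm_mul_le _ _)
    (((hA 0 y).norm).mul_continuousOn (continuous_propagator hA).norm.continuousOn)

theorem norm_propagator_sub_one_le {x : ℝ} (hx : 0 ≤ x) :
    ‖propagator A x - 1‖
      ≤ (∫ t in (0 : ℝ)..x, ‖A t‖) * (‖(1 : E)‖ * Real.exp (∫ t in (0 : ℝ)..x, ‖A t‖)) := by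
  have h := (isPrimitive_propagator hA).sub_eq_integral 0 x
  rw [propagator_zero hA] at h
  rw [h]
  refine norm_integral_mul_le hA hx fun t ht => (norm_propagator_le hA ht.1).trans ?_
  gcongr
  exact monotoneOn_integral_norm hA ht.1 hx ht.2

theorem norm_propagator_sub_one_sub_integral_le {x : ℝ} (hx : 0 ≤ x) :
    ‖propagator A x - 1 - ∫ t in (0 : ℝ)..x, A t‖
      ≤ (∫ t in (0 : ℝ)..x, ‖A t‖) ^ 2
        * (‖(1 : E)‖ * Real.exp (∫ t in (0 : ℝ)..x, ‖A t‖)) := by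
  have h : propagator A x - 1 - ∫ t in (0 : ℝ)..x, A t
      = ∫ t in (0 : ℝ)..x, A t * (propagator A t - 1) := by
    have := (isPrimitive_propagator hA).sub_eq_integral 0 x
    rw [propagator_zero hA] at this
    simp only [mul_sub, mul_one]
    rw [this, intervalIntegral.integral_sub ((isPrimitive_propagator hA).intervalIntegrable 0 x)
      (hA 0 x)]
  rw [h, sq, mul_assoc]
  refine norm_integral_mul_le hA hx fun t ht => (norm_propagator_sub_one_le hA ht.1).trans ?_
  have hmono := monotoneOn_integral_norm hA ht.1 hx ht.2
  have hnonneg : 0 ≤ ∫ t in (0 : ℝ)..x, ‖A t‖ :=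
    intervalIntegral.integral_nonneg hx fun _ _ => norm_nonneg _
  dsimp only at hmono
  gcongr

variable [IsDedekindFiniteMonoid E]

theorem exists_inverse_propagator :
    ∃ Z : ℝ → E, IsPrimitive Z (fun t => -(Z t * A t))
      ∧ ∀ x, Z x * propagator A x = 1 ∧ propagator A x * Z x = 1 := by
  obtain ⟨Z, hZ0, hZ⟩ := exists_isPrimitive_mul_coeff (A := -A) fun x y => (hA x y).neg
  simp only [Pi.neg_apply, mul_neg] at hZ
  have hZY : ∀ x, Z x * propagator A x = 1 := fun x => by
    have h := ((hZ.mul (isPrimitive_propagator hA)).congr (g := fun _ => 0)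
      (Eventually.of_forall fun t => by noncomm_ring)).eq_of_zero x
    rwa [hZ0, propagator_zero hA, one_mul] at h
  exact ⟨Z, hZ, fun x => ⟨hZY x, mul_eq_one_comm.1 (hZY x)⟩⟩

theorem isUnit_propagator (x : ℝ) : IsUnit (propagator A x) := by
  obtain ⟨Z, -, hZ⟩ := exists_inverse_propagator hA
  exact ⟨⟨_, _, (hZ x).2, (hZ x).1⟩, rfl⟩

theorem isPrimitive_inverse_propagator :
    IsPrimitive (fun x => Ring.inverse (propagator A x))
      (fun t => -(Ring.inverse (propagator A t) * A t)) := by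
  obtain ⟨Z, hZ, hZY⟩ := exists_inverse_propagator hA
  have h : ∀ x, Ring.inverse (propagator A x) = Z x := fun x =>
    Ring.inverse_unit ⟨propagator A x, Z x, (hZY x).2, (hZY x).1⟩
  simpa only [h] using hZ

theorem eq_propagator_mul {W : ℝ → E} (hW : IsPrimitive W (fun t => A t * W t)) (x : ℝ) :
    W x = propagator A x * W 0 := by
  obtain ⟨Z, hZ, hZY⟩ := exists_inverse_propagator hA
  have hZ0 : Z 0 = 1 := by simpa [propagator_zero hA] using (hZY 0).1
  have h := ((hZ.mul hW).congr (g := fun _ => 0)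
    (Eventually.of_forall fun t => by noncomm_ring)).eq_of_zero x
  rw [hZ0, one_mul] at h
  rw [← h, ← mul_assoc, (hZY x).2, one_mul]

theorem propagator_congr {A' : ℝ → E} (h : A =ᵐ[volume] A') : propagator A' = propagator A := by
  have hA' : ∀ x y, IntervalIntegrable A' volume x y :=
    fun x y => (hA x y).congr_ae (ae_restrict_of_ae h)
  ext x
  have hY := eq_propagator_mul hA ((isPrimitive_propagator hA').congr (g := fun t => A t * _) (by
    filter_upwards [h] with t ht using by rw [ht])) x
  rwa [propagator_zero hA', mul_one] at hY

theorem propagator_add_time (s t : ℝ) :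
    propagator A (s + t) = propagator (fun r => A (s + r)) t * propagator A s := by
  simpa using eq_propagator_mul ((IsPrimitive.integral hA).comp_const_add s).intervalIntegrable
    ((isPrimitive_propagator hA).comp_const_add s) t

theorem propagator_add_coeff {B : ℝ → E} (hB : ∀ x y, IntervalIntegrable B volume x y) (x : ℝ) :
    propagator (fun t => A t + B t) x = propagator A x
      * propagator (fun t => Ring.inverse (propagator A t) * B t * propagator A t) x := by
  have hY := isPrimitive_propagator hA
  have hC : ∀ x y, IntervalIntegrable
      (fun t => Ring.inverse (propagator A t) * B t * propagator A t) volume x y := fun x y =>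
    ((hB x y).continuousOn_mul (isPrimitive_inverse_propagator hA).continuous.continuousOn
      ).mul_continuousOn hY.continuous.continuousOn
  have h := eq_propagator_mul (fun x y => (hA x y).add (hB x y))
    ((hY.mul (isPrimitive_propagator hC)).congr (g := fun t => (A t + B t) * (_ * _))
      (Eventually.of_forall fun t => by
        have hinv := Ring.mul_inverse_cancel _ (isUnit_propagator hA t)
        simp only [add_mul, ← mul_assoc, hinv, one_mul])) x
  rw [h, propagator_zero hA, propagator_zero hC, mul_one, mul_one]

theorem ae_eq_of_propagator_eq {A' : ℝ → E} (hA' : ∀ x y, IntervalIntegrable A' volume x y)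
    {X : ℝ} (h : ∀ x ∈ Ioo 0 X, propagator A x = propagator A' x) :
    ∀ᵐ t, t ∈ Ioo 0 X → A t = A' t := by
  filter_upwards [(isPrimitive_propagator hA).ae_hasDerivAt,
    (isPrimitive_propagator hA').ae_hasDerivAt] with t ht ht' hmem
  have hd := ht.unique (ht'.congr_of_eventuallyEq
    (Filter.mem_of_superset (isOpen_Ioo.mem_nhds hmem) h))
  rw [← h t hmem] at hd
  exact (isUnit_propagator hA t).mul_right_cancel hd

end LinearEquation

section Parameter
open MeasureTheory Set Filter Asymptotics

variable {E : Type*} [NormedRing E] [NormedAlgebra ℂ E] [CompleteSpace E]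

theorem hasDerivAt_propagator_smul_zero {C : ℝ → E}
    (hC : ∀ x y, IntervalIntegrable C volume x y) {x : ℝ} (hx : 0 ≤ x) :
    HasDerivAt (fun h : ℂ => propagator (fun t => h • C t) x) (∫ t in (0 : ℝ)..x, C t) 0 := by
  set K := ∫ t in (0 : ℝ)..x, ‖C t‖
  have hK : 0 ≤ K := intervalIntegral.integral_nonneg hx fun _ _ => norm_nonneg _
  have hbound : ∀ h : ℂ, ‖h‖ ≤ 1 → ‖propagator (fun t => h • C t) x - 1
      - h • ∫ t in (0 : ℝ)..x, C t‖ ≤ K ^ 2 * (‖(1 : E)‖ * Real.exp K) * ‖h ^ 2‖ := fun h hh => by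
    have := norm_propagator_sub_one_sub_integral_le (fun x y => (hC x y).smul h) hx
    simp only [norm_smul, intervalIntegral.integral_const_mul, Pi.smul_apply,
      intervalIntegral.integral_smul] at this
    have hexp : ‖h‖ * K ≤ K := mul_le_of_le_one_left hK hh
    calc _ ≤ _ := this
      _ ≤ (‖h‖ * K) ^ 2 * (‖(1 : E)‖ * Real.exp K) := by gcongr
      _ = _ := by rw [norm_pow]; ring
  have hzero : propagator (fun t => (0 : ℂ) • C t) x = 1 := by
    simpa [sub_eq_zero] using hbound 0 (by simp)
  rw [hasDerivAt_iff_isLittleO_nhds_zero]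
  simp only [zero_add, hzero]
  refine IsBigO.trans_isLittleO (g := fun h : ℂ => h ^ 2)
    (.of_bound (K ^ 2 * (‖(1 : E)‖ * Real.exp K)) ?_)
    (isLittleO_pow_id one_lt_two)
  filter_upwards [Metric.closedBall_mem_nhds (0 : ℂ) one_pos] with h hh
  exact hbound h (by simpa using hh)

variable [IsDedekindFiniteMonoid E]

theorem hasDerivAt_propagator_add_smul {A B : ℝ → E}
    (hA : ∀ x y, IntervalIntegrable A volume x y) (hB : ∀ x y, IntervalIntegrable B volume x y)
    {x : ℝ} (hx : 0 ≤ x) (lam : ℂ) {Y : ℝ → E} (hY : Y = propagator fun t => A t + lam • B t) :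
    HasDerivAt (fun μ : ℂ => propagator (fun t => A t + μ • B t) x)
      (Y x * ∫ t in (0 : ℝ)..x, Ring.inverse (Y t) * B t * Y t) lam := by
  have hAB : ∀ x y, IntervalIntegrable (fun t => A t + lam • B t) volume x y :=
    fun x y => (hA x y).add ((hB x y).smul lam)
  have hC : ∀ x y, IntervalIntegrable (fun t => Ring.inverse (Y t) * B t * Y t) volume x y :=
    fun x y => hY ▸ ((hB x y).continuousOn_mul
      (isPrimitive_inverse_propagator hAB).continuous.continuousOn).mul_continuousOn
      (continuous_propagator hAB).continuousOn
  have hfactor : ∀ μ : ℂ, propagator (fun t => A t + μ • B t) x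
      = Y x * propagator (fun t => (μ - lam) • (Ring.inverse (Y t) * B t * Y t)) x := fun μ => by
    have := propagator_add_coeff hAB (fun x y => (hB x y).smul (μ - lam)) x
    simp only [Pi.smul_apply, mul_smul_comm, smul_mul_assoc, ← hY] at this
    rw [← this]
    congr! 2 with t
    module
  simp only [hfactor]
  exact (HasDerivAt.comp_sub_const (f := fun h => propagator _ x) lam lam
    (by simpa using hasDerivAt_propagator_smul_zero hC hx)).const_mul _

end Parameter

section RiemannLebesgue
open MeasureTheory Set Filter

variable {E : Type*} [NormedAddCommGroup E]

theorem exists_contDiff_integral_norm_sub_le [NormedSpace ℝ E] {f : ℝ → E} {X : ℝ} (hX : 0 ≤ X)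
    (hf : IntervalIntegrable f volume 0 X) {ε : ℝ} (hε : 0 < ε) :
    ∃ g : ℝ → E, ContDiff ℝ 1 g ∧ ∫ t in (0 : ℝ)..X, ‖f t - g t‖ ≤ ε := by
  have hf' := (intervalIntegrable_iff_integrableOn_Ioc_of_le hX).1 hf
  obtain ⟨g, -, hg, h⟩ := MemLp.exist_eLpNorm_sub_le (p := 1) ENNReal.one_ne_top le_rfl
    (memLp_one_iff_integrable.2 hf') hε
  have hg' : IntegrableOn g (Ioc 0 X) :=
    (intervalIntegrable_iff_integrableOn_Ioc_of_le hX).1 (hg.continuous.intervalIntegrable 0 X)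
  refine ⟨g, hg.of_le (by exact_mod_cast le_top), ?_⟩
  rw [eLpNorm_one_eq_lintegral_enorm, ← ofReal_integral_norm_eq_lintegral_enorm (hf'.sub hg'),
    ENNReal.ofReal_le_ofReal_iff hε.le] at h
  rwa [intervalIntegral.integral_of_le hX]

variable [NormedSpace ℂ E]

/-- The weight `exp (c |Im z|)` against which solutions of exponential type `c` are measured. -/
noncomputable def growth (c : ℝ) (z : ℂ) : ℝ := Real.exp (c * |z.im|)

theorem growth_pos (c : ℝ) (z : ℂ) : 0 < growth c z :=
  Real.exp_pos _

theorem norm_growth (c : ℝ) (z : ℂ) : ‖growth c z‖ = growth c z :=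
  Real.norm_of_nonneg (growth_pos c z).le

theorem growth_add (b c : ℝ) (z : ℂ) : growth (b + c) z = growth b z * growth c z := by
  rw [growth, add_mul, Real.exp_add, growth, growth]

theorem norm_cexp_mul_sub_two_mul_le (z : ℂ) {x t : ℝ} (ht : t ∈ Icc 0 x) :
    ‖Complex.exp (Complex.I * z * (x - 2 * t))‖ ≤ growth x z := by
  have hle : |x - 2 * t| ≤ x := abs_le.2 ⟨by linarith [ht.2], by linarith [ht.1]⟩
  rw [Complex.norm_exp, growth, Real.exp_le_exp]
  calc _ = (x - 2 * t) * -z.im := by simp; ring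
    _ ≤ |x - 2 * t| * |z.im| := by rw [← abs_neg z.im, ← abs_mul]; exact le_abs_self _
    _ ≤ x * |z.im| := by gcongr

theorem norm_integral_cexp_smul_le {f : ℝ → E} {x : ℝ} (hx : 0 ≤ x)
    (hf : IntervalIntegrable f volume 0 x) (z : ℂ) :
    ‖∫ t in (0 : ℝ)..x, Complex.exp (Complex.I * z * (x - 2 * t)) • f t‖
      ≤ growth x z * ∫ t in (0 : ℝ)..x, ‖f t‖ := by
  rw [← intervalIntegral.integral_const_mul]
  refine intervalIntegral.norm_integral_le_of_norm_le hx (Eventually.of_forall fun t ht => ?_)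
    (hf.norm.const_mul _)
  rw [norm_smul]
  gcongr
  exact norm_cexp_mul_sub_two_mul_le z ⟨ht.1.le, ht.2⟩

variable [CompleteSpace E]

theorem two_mul_I_mul_smul_integral_cexp_smul {g : ℝ → E} (hg : ContDiff ℝ 1 g) (z : ℂ) (x : ℝ) :
    (2 * Complex.I * z) • ∫ t in (0 : ℝ)..x, Complex.exp (Complex.I * z * (x - 2 * t)) • g t
      = Complex.exp (Complex.I * z * x) • g 0 - Complex.exp (-(Complex.I * z * x)) • g x
        + ∫ t in (0 : ℝ)..x, Complex.exp (Complex.I * z * (x - 2 * t)) • deriv g t := by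
  have hu : ∀ t : ℝ, HasDerivAt (fun t : ℝ => Complex.exp (Complex.I * z * (x - 2 * t)))
      (-(2 * Complex.I * z) * Complex.exp (Complex.I * z * (x - 2 * t))) t := fun t => by
    have ht : HasDerivAt (fun t : ℝ => (t : ℂ)) 1 t := (hasDerivAt_id t).ofReal_comp
    convert (((ht.const_mul 2).const_sub (x : ℂ)).const_mul (Complex.I * z)).cexp using 1
    ring
  have hparts := intervalIntegral.integral_smul_deriv_eq_deriv_smul (a := 0) (b := x)
    (fun t _ => hu t) (fun t _ => (hg.differentiable one_ne_zero t).hasDerivAt)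
    (Continuous.intervalIntegrable (by fun_prop) _ _)
    ((hg.continuous_deriv le_rfl).intervalIntegrable _ _)
  rw [hparts]
  simp only [mul_smul, neg_smul, neg_mul, intervalIntegral.integral_neg,
    intervalIntegral.integral_smul]
  rw [show Complex.I * z * (x - 2 * x) = -(Complex.I * z * x) by ring]
  simp
  abel

theorem exists_norm_mul_norm_integral_cexp_smul_le {g : ℝ → E} (hg : ContDiff ℝ 1 g) (X : ℝ) :
    ∃ C : ℝ, ∀ z : ℂ, ∀ x ∈ Icc 0 X,
      ‖z‖ * ‖∫ t in (0 : ℝ)..x, Complex.exp (Complex.I * z * (x - 2 * t)) • g t‖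
        ≤ C * growth x z := by
  have hg' := (hg.continuous_deriv le_rfl).intervalIntegrable (μ := volume)
  obtain ⟨C, hC⟩ := (isCompact_Icc (a := 0) (b := X)).exists_bound_of_continuousOn
    (f := fun x => ‖g 0‖ + ‖g x‖ + ∫ t in (0 : ℝ)..x, ‖deriv g t‖)
    (((continuous_const.add hg.continuous.norm).add
      (IsPrimitive.integral fun x y => (hg' x y).norm).continuous).continuousOn)
  refine ⟨C, fun z x hx => ?_⟩
  have hstart := norm_cexp_mul_sub_two_mul_le z (left_mem_Icc.2 hx.1)
  have hend := norm_cexp_mul_sub_two_mul_le z (right_mem_Icc.2 hx.1)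
  rw [show Complex.I * z * (x - 2 * (0 : ℝ)) = Complex.I * z * x by push_cast; ring] at hstart
  rw [show Complex.I * z * (x - 2 * x) = -(Complex.I * z * x) by ring] at hend
  set J := ∫ t in (0 : ℝ)..x, Complex.exp (Complex.I * z * (x - 2 * t)) • g t
  calc ‖z‖ * ‖J‖ ≤ ‖(2 * Complex.I * z) • J‖ := by
        rw [norm_smul]
        gcongr
        simpa using le_mul_of_one_le_left (norm_nonneg z) one_le_two
    _ ≤ growth x z * ‖g 0‖ + growth x z * ‖g x‖
        + growth x z * ∫ t in (0 : ℝ)..x, ‖deriv g t‖ := by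
        rw [two_mul_I_mul_smul_integral_cexp_smul hg]
        refine (norm_add_le _ _).trans (add_le_add ((norm_sub_le _ _).trans ?_)
          (norm_integral_cexp_smul_le hx.1 (hg' 0 x) z))
        rw [norm_smul, norm_smul]
        gcongr
    _ ≤ C * growth x z := by
        rw [← mul_add, ← mul_add, mul_comm]
        exact mul_le_mul_of_nonneg_right ((le_abs_self _).trans (hC x hx)) (Real.exp_nonneg _)

theorem exists_forall_norm_integral_cexp_smul_le {f : ℝ → E} {X : ℝ} (hX : 0 ≤ X)
    (hf : IntervalIntegrable f volume 0 X) {ε : ℝ} (hε : 0 < ε) :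
    ∃ K : ℝ, ∀ z : ℂ, K ≤ ‖z‖ → ∀ x ∈ Icc 0 X,
      ‖∫ t in (0 : ℝ)..x, Complex.exp (Complex.I * z * (x - 2 * t)) • f t‖ ≤ ε * growth x z := by
  obtain ⟨g, hg, hfg⟩ := exists_contDiff_integral_norm_sub_le hX hf (half_pos hε)
  obtain ⟨C, hC⟩ := exists_norm_mul_norm_integral_cexp_smul_le hg X
  refine ⟨max 1 (2 * C / ε), fun z hz x hx => ?_⟩
  have hz₀ : 0 < ‖z‖ := one_pos.trans_le ((le_max_left _ _).trans hz)
  have hsub : IntervalIntegrable (fun t => f t - g t) volume 0 X :=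
    hf.sub (hg.continuous.intervalIntegrable 0 X)
  have hxX : uIcc 0 x ⊆ uIcc 0 X := by
    rw [uIcc_of_le hx.1, uIcc_of_le hX]
    exact Icc_subset_Icc_right hx.2
  have hsmooth : ‖∫ t in (0 : ℝ)..x, Complex.exp (Complex.I * z * (x - 2 * t)) • g t‖
      ≤ ε / 2 * growth x z := by
    refine le_of_mul_le_mul_left ((hC z x hx).trans ?_) hz₀
    rw [← mul_assoc]
    refine mul_le_mul_of_nonneg_right ?_ (Real.exp_nonneg _)
    have := (div_le_iff₀ hε).1 ((le_max_right _ _).trans hz)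
    linarith
  have hrest : ‖∫ t in (0 : ℝ)..x, Complex.exp (Complex.I * z * (x - 2 * t)) • (f t - g t)‖
      ≤ growth x z * (ε / 2) := by
    refine (norm_integral_cexp_smul_le hx.1 (hsub.mono_set hxX) z).trans ?_
    refine mul_le_mul_of_nonneg_left (le_trans ?_ hfg) (Real.exp_nonneg _)
    exact intervalIntegral.integral_mono_interval le_rfl hx.1 hx.2
      (Eventually.of_forall fun _ => norm_nonneg _) hsub.norm
  have hexp : ContinuousOn (fun t : ℝ => Complex.exp (Complex.I * z * (x - 2 * t))) (uIcc 0 x) := by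
    fun_prop
  have hsplit : ∫ t in (0 : ℝ)..x, Complex.exp (Complex.I * z * (x - 2 * t)) • f t
      = (∫ t in (0 : ℝ)..x, Complex.exp (Complex.I * z * (x - 2 * t)) • (f t - g t))
        + ∫ t in (0 : ℝ)..x, Complex.exp (Complex.I * z * (x - 2 * t)) • g t := by
    rw [← intervalIntegral.integral_add ((hsub.mono_set hxX).continuousOn_smul hexp)
      ((hg.continuous.intervalIntegrable 0 x).continuousOn_smul hexp)]
    simp only [smul_sub, sub_add_cancel]
  rw [hsplit]
  linarith [norm_add_le_of_le hrest hsmooth]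

end RiemannLebesgue
section Exponential
open NormedSpace

variable {E : Type*} [NormedRing E] [NormedAlgebra ℂ E] [CompleteSpace E] {j m : E}

theorem exp_add_smul (j : E) (a b : ℂ) : exp ((a + b) • j) = exp (a • j) * exp (b • j) := by
  let _ := NormedAlgebra.restrictScalars ℚ ℂ E
  rw [add_smul, exp_add_of_commute (((Commute.refl j).smul_left a).smul_right b)]

theorem exp_smul_mul_exp_neg_smul (j : E) (a : ℂ) : exp (a • j) * exp (-a • j) = 1 := by
  rw [← exp_add_smul, add_neg_cancel, zero_smul, exp_zero]

theorem exp_smul_of_mul_self_eq_neg_one (hj : j * j = -1) (z : ℂ) :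
    exp (z • j) = Complex.cos z • 1 + Complex.sin z • j := by
  let S : ℂ → E := fun z => Complex.cos z • 1 + Complex.sin z • j
  have hS : ∀ z, HasDerivAt S (j * S z) z := fun z => by
    refine (((Complex.hasDerivAt_cos z).smul_const (1 : E)).fun_add
      ((Complex.hasDerivAt_sin z).smul_const j)).congr_deriv ?_
    simp only [S, mul_add, mul_smul_comm, mul_one, hj]
    module
  have hd : ∀ z, HasDerivAt (fun z => exp (z • -j) * S z) 0 z := fun z =>
    ((hasDerivAt_exp_smul_const (-j) z).fun_mul (hS z)).congr_deriv (by noncomm_ring)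
  have hone : exp (-z • j) * S z = 1 := by
    simpa [S] using is_const_of_deriv_eq_zero (fun z => (hd z).differentiableAt)
      (fun z => (hd z).deriv) z 0
  calc exp (z • j) = exp (z • j) * (exp (-z • j) * S z) := by rw [hone, mul_one]
    _ = S z := by rw [← mul_assoc, exp_smul_mul_exp_neg_smul, one_mul]

theorem mul_exp_smul_of_anticommute (hj : j * j = -1) (hm : j * m = -(m * j)) (a : ℂ) :
    m * exp (a • j) = exp (-a • j) * m := by
  rw [exp_smul_of_mul_self_eq_neg_one hj, exp_smul_of_mul_self_eq_neg_one hj, Complex.cos_neg,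
    Complex.sin_neg, mul_add, add_mul, mul_smul_comm, mul_smul_comm, smul_mul_assoc,
    smul_mul_assoc, hm, neg_smul, smul_neg, neg_neg, mul_one, one_mul]

omit [CompleteSpace E] in
theorem two_mul_cos_smul_add_sin_smul (j : E) (z : ℂ) :
    (2 : ℂ) • (Complex.cos z • 1 + Complex.sin z • j)
      = Complex.exp (Complex.I * z) • (1 - Complex.I • j)
        + Complex.exp (Complex.I * -z) • (1 + Complex.I • j) := by
  rw [mul_neg, mul_comm Complex.I z, ← neg_mul, Complex.exp_mul_I, Complex.exp_mul_I,
    Complex.cos_neg, Complex.sin_neg]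
  match_scalars
  · ring
  · linear_combination (2 * Complex.sin z) * Complex.I_sq

theorem two_smul_exp_smul (hj : j * j = -1) (z : ℂ) :
    (2 : ℂ) • exp (z • j) = Complex.exp (Complex.I * z) • (1 - Complex.I • j)
      + Complex.exp (Complex.I * -z) • (1 + Complex.I • j) := by
  rw [exp_smul_of_mul_self_eq_neg_one hj, two_mul_cos_smul_add_sin_smul]

theorem norm_exp_smul_le (hj : j * j = -1) (z : ℂ) :
    ‖exp (z • j)‖ ≤ Real.exp |z.im| * (‖(1 : E)‖ + ‖j‖) := by
  have hcexp : ∀ w : ℂ, ‖Complex.exp (Complex.I * w)‖ ≤ Real.exp |w.im| := fun w => by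
    rw [Complex.norm_exp, Real.exp_le_exp]
    simpa using neg_le_abs w.im
  have hI : ‖Complex.I • j‖ = ‖j‖ := by rw [norm_smul, Complex.norm_I, one_mul]
  have hadd : ‖1 + Complex.I • j‖ ≤ ‖(1 : E)‖ + ‖j‖ := hI ▸ norm_add_le _ _
  have hsub : ‖1 - Complex.I • j‖ ≤ ‖(1 : E)‖ + ‖j‖ := hI ▸ norm_sub_le _ _
  have h2 : 2 * ‖exp (z • j)‖
      ≤ Real.exp |z.im| * (‖(1 : E)‖ + ‖j‖) + Real.exp |z.im| * (‖(1 : E)‖ + ‖j‖) := by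
    rw [← Complex.norm_two, ← norm_smul, two_smul_exp_smul hj]
    refine (norm_add_le _ _).trans (add_le_add ?_ ?_) <;> rw [norm_smul] <;> gcongr
    · exact hcexp z
    · simpa using hcexp (-z)
  linarith

theorem exp_add_smul_one {E : Type*} [NormedRing E] [NormedAlgebra ℂ E] [CompleteSpace E] (a : E)
    (z : ℂ) : exp (a + z • 1) = Complex.exp z • exp a := by
  let _ := NormedAlgebra.restrictScalars ℚ ℂ E
  rw [← Algebra.algebraMap_eq_smul_one, exp_add_of_commute (Algebra.commute_algebraMap_right z a),
    ← algebraMap_exp_comm, ← Complex.exp_eq_exp_ℂ, ← Algebra.commutes, Algebra.smul_def]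

theorem exp_smul_I_smul_one {E : Type*} [NormedRing E] [NormedAlgebra ℂ E] [CompleteSpace E]
    (z : ℂ) : exp (z • Complex.I • (1 : E)) = Complex.exp (Complex.I * z) • 1 := by
  rw [← zero_add (z • Complex.I • (1 : E)), smul_smul, exp_add_smul_one, exp_zero, mul_comm]

end Exponential

section Asymptotics
open MeasureTheory Set Filter Asymptotics NormedSpace

variable {E : Type*} [NormedRing E] [NormedAlgebra ℂ E] {j : E} {M : ℝ → E}

theorem intervalIntegrable_sub_smul (hM : ∀ x y, IntervalIntegrable M volume x y) (j : E)
    (lam : ℂ) (x y : ℝ) : IntervalIntegrable (fun t => M t - lam • j) volume x y :=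
  (hM x y).sub intervalIntegrable_const

variable [CompleteSpace E] (hj : j * j = -1) (hM : ∀ x y, IntervalIntegrable M volume x y)

theorem continuous_exp_smul (j : E) {f : ℝ → ℂ} (hf : Continuous f) :
    Continuous fun t => exp (f t • j) :=
  (continuous_iff_continuousAt.2 fun z => (hasDerivAt_exp_smul_const j z).continuousAt).comp hf

theorem isPrimitive_exp_smul {α a : ℝ → ℝ} (hα : IsPrimitive α a) (j : E) :
    IsPrimitive (fun t => exp ((α t : ℂ) • j)) (fun t => exp ((α t : ℂ) • j) * ((a t : ℂ) • j)) :=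
  (hα.comp (F := fun r => exp ((r : ℂ) • j)) (f := fun r => exp ((r : ℂ) • j) * j)
    (fun r => by
      simpa [Function.comp_def] using
        (hasDerivAt_exp_smul_const j (r : ℂ)).scomp r (hasDerivAt_id r).ofReal_comp)
    ((continuous_exp_smul j Complex.continuous_ofReal).mul_const j)).congr
    (.of_forall fun t => by simp only [mul_smul_comm, Complex.coe_smul])

include hM in
theorem propagator_eq_exp_add_integral (lam : ℂ) (x : ℝ) :
    propagator (fun t => M t - lam • j) x = exp (-(lam * x) • j)
      + ∫ t in (0 : ℝ)..x, exp (-(lam * (x - t)) • j) * M t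
        * propagator (fun t => M t - lam • j) t := by
  set S := propagator fun t => M t - lam • j
  have hA := intervalIntegrable_sub_smul hM j lam
  have hE : IsPrimitive (fun t : ℝ => exp ((lam * t) • j))
      (fun t => exp ((lam * t) • j) * (lam • j)) := by
    simpa [smul_smul, mul_comm lam] using
      isPrimitive_exp_smul (.of_hasDerivAt hasDerivAt_id continuous_const) (lam • j)
  have h : IsPrimitive (fun t : ℝ => exp ((lam * t) • j) * S t)
      (fun t => exp ((lam * t) • j) * M t * S t) :=
    (hE.mul (isPrimitive_propagator hA)).congr (Eventually.of_forall fun t => by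
      simp only [mul_assoc, ← mul_add, ← add_mul, add_sub_cancel, S])
  have hx := (h.clm (ContinuousLinearMap.mul ℝ E (exp (-(lam * x) • j)))).eq_integral x
  have hexp : ∀ t : ℝ, exp (-(lam * x) • j) * exp ((lam * t) • j) = exp (-(lam * (x - t)) • j) :=
    fun t => by rw [← exp_add_smul]; ring_nf
  simpa only [ContinuousLinearMap.mul_apply', ← mul_assoc, hexp, sub_self, mul_zero, neg_zero,
    zero_smul, exp_zero, one_mul, S, propagator_zero hA, Complex.ofReal_zero, sub_zero, mul_one]
    using hx

include hj in
theorem exp_mul_mul_exp_of_anticommute {m : E} (hm : j * m = -(m * j)) (a b : ℂ) :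
    exp (-a • j) * m * exp (-b • j) = exp (-(a - b) • j) * m := by
  rw [mul_assoc, mul_exp_smul_of_anticommute hj hm, ← mul_assoc, ← exp_add_smul]
  ring_nf

include hj hM in
theorem exists_forall_norm_integral_exp_smul_mul_le {X : ℝ} (hX : 0 ≤ X) {ε : ℝ} (hε : 0 < ε) :
    ∃ K : ℝ, ∀ lam : ℂ, K ≤ ‖lam‖ → ∀ x ∈ Icc 0 X,
      ‖∫ t in (0 : ℝ)..x, exp (-(lam * (x - 2 * t)) • j) * M t‖ ≤ ε * growth x lam := by
  have hint : ∀ e : E, ∀ x y, IntervalIntegrable (fun t => e * M t) volume x y :=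
    fun e x y => (hM x y).continuousOn_mul continuousOn_const
  obtain ⟨K₁, hK₁⟩ := exists_forall_norm_integral_cexp_smul_le hX
    (hint (1 - Complex.I • j) 0 X) hε
  obtain ⟨K₂, hK₂⟩ := exists_forall_norm_integral_cexp_smul_le hX
    (hint (1 + Complex.I • j) 0 X) hε
  refine ⟨max K₁ K₂, fun lam hlam x hx => ?_⟩
  have h₁ := hK₁ (-lam) (by simpa using (le_max_left _ _).trans hlam) x hx
  have h₂ := hK₂ lam ((le_max_right _ _).trans hlam) x hx
  have hcont : ∀ a : ℂ, Continuous fun t : ℝ => Complex.exp (Complex.I * a * (x - 2 * t)) :=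
    fun a => by fun_prop
  have hsplit : (2 : ℂ) • ∫ t in (0 : ℝ)..x, exp (-(lam * (x - 2 * t)) • j) * M t
      = (∫ t in (0 : ℝ)..x,
          Complex.exp (Complex.I * -lam * (x - 2 * t)) • ((1 - Complex.I • j) * M t))
        + ∫ t in (0 : ℝ)..x,
          Complex.exp (Complex.I * lam * (x - 2 * t)) • ((1 + Complex.I • j) * M t) := by
    rw [← intervalIntegral.integral_smul, ← intervalIntegral.integral_add
      ((hint _ 0 x).continuousOn_smul (hcont _).continuousOn)
      ((hint _ 0 x).continuousOn_smul (hcont _).continuousOn)]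
    refine intervalIntegral.integral_congr fun t _ => ?_
    rw [← smul_mul_assoc, two_smul_exp_smul hj, add_mul, smul_mul_assoc, smul_mul_assoc]
    ring_nf
  have htwo : 2 * ‖∫ t in (0 : ℝ)..x, exp (-(lam * (x - 2 * t)) • j) * M t‖
      ≤ ε * growth x lam + ε * growth x lam := by
    rw [← Complex.norm_two, ← norm_smul, hsplit]
    refine (norm_add_le _ _).trans (add_le_add ?_ h₂)
    simpa [growth] using h₁
  linarith

include hj hM in
theorem norm_integral_exp_smul_mul_le {D : ℝ → E} (hD : Continuous D) (lam : ℂ) {x : ℝ}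
    (hx : 0 ≤ x) :
    ‖∫ t in (0 : ℝ)..x, exp (-(lam * (x - t)) • j) * M t * D t‖
      ≤ (∫ t in (0 : ℝ)..x, (‖(1 : E)‖ + ‖j‖) * ‖M t‖ * (‖D t‖ * growth (-t) lam))
        * growth x lam := by
  have hgrowth : Continuous fun t => growth (-t) lam := by unfold growth; fun_prop
  rw [← intervalIntegral.integral_mul_const]
  refine intervalIntegral.norm_integral_le_of_norm_le hx (Eventually.of_forall fun t ht => ?_)
    ((((hM 0 x).norm.const_mul _).mul_continuousOn (hD.norm.mul hgrowth).continuousOn).mul_const _)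
  have hexp := norm_exp_smul_le hj (-(lam * (x - t)))
  have him : |(-(lam * ((x : ℂ) - t))).im| = x * |lam.im| + -t * |lam.im| := by
    rw [← Complex.ofReal_sub, Complex.neg_im, Complex.im_mul_ofReal, abs_neg, abs_mul,
      abs_of_nonneg (sub_nonneg.2 ht.2)]
    ring
  rw [him, Real.exp_add] at hexp
  calc _ ≤ ‖exp (-(lam * (x - t)) • j)‖ * ‖M t‖ * ‖D t‖ := norm_mul₃_le
    _ ≤ growth x lam * growth (-t) lam * (‖(1 : E)‖ + ‖j‖) * ‖M t‖ * ‖D t‖ := by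
      gcongr; exact hexp
    _ = _ := by ring

variable (hMj : ∀ t, j * M t = -(M t * j))
include hj hM hMj

theorem propagator_sub_exp_eq (lam : ℂ) (x : ℝ) :
    propagator (fun t => M t - lam • j) x - exp (-(lam * x) • j)
      = (∫ t in (0 : ℝ)..x, exp (-(lam * (x - 2 * t)) • j) * M t)
        + ∫ t in (0 : ℝ)..x, exp (-(lam * (x - t)) • j) * M t
          * (propagator (fun t => M t - lam • j) t - exp (-(lam * t) • j)) := by
  have hS := continuous_propagator (intervalIntegrable_sub_smul hM j lam)
  have h₁ : IntervalIntegrable (fun t : ℝ => exp (-(lam * (x - 2 * t)) • j) * M t) volume 0 x :=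
    (hM 0 x).continuousOn_mul (continuous_exp_smul j (by fun_prop)).continuousOn
  have h₂ : IntervalIntegrable (fun t : ℝ => exp (-(lam * (x - t)) • j) * M t
      * (propagator (fun t => M t - lam • j) t - exp (-(lam * t) • j))) volume 0 x :=
    ((hM 0 x).continuousOn_mul (continuous_exp_smul j (by fun_prop)).continuousOn).mul_continuousOn
      (hS.sub (continuous_exp_smul j (by fun_prop))).continuousOn
  rw [propagator_eq_exp_add_integral hM, add_sub_cancel_left,
    ← intervalIntegral.integral_add h₁ h₂]
  refine intervalIntegral.integral_congr fun t _ => ?_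
  have hflip := exp_mul_mul_exp_of_anticommute hj (hMj t) (lam * (x - t)) (lam * t)
  rw [show lam * (x - t) - lam * t = lam * (x - 2 * t) by ring] at hflip
  rw [mul_sub (_ * M t), hflip, add_sub_cancel]

theorem norm_propagator_sub_exp_le {lam : ℂ} {δ X : ℝ} (hX : 0 ≤ X)
    (h : ∀ x ∈ Icc 0 X, ‖∫ t in (0 : ℝ)..x, exp (-(lam * (x - 2 * t)) • j) * M t‖
      ≤ δ * growth x lam) :
    ‖propagator (fun t => M t - lam • j) X - exp (-(lam * X) • j)‖
      ≤ δ * Real.exp (∫ t in (0 : ℝ)..X, (‖(1 : E)‖ + ‖j‖) * ‖M t‖) * growth X lam := by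
  set D : ℝ → E := fun t => propagator (fun t => M t - lam • j) t - exp (-(lam * t) • j)
  set w : ℝ → ℝ := fun t => growth (-t) lam
  have hw : ∀ x, growth x lam * w x = 1 := fun x => by
    rw [← growth_add, add_neg_cancel, growth, zero_mul, Real.exp_zero]
  have hwpos : ∀ x, 0 ≤ w x := fun x => (growth_pos _ _).le
  have hD : Continuous D := (continuous_propagator (intervalIntegrable_sub_smul hM j lam)).sub
    (continuous_exp_smul j (by fun_prop))
  have hwc : Continuous w := by unfold w growth; fun_prop
  have ha : ∀ x y, IntervalIntegrable (fun t => (‖(1 : E)‖ + ‖j‖) * ‖M t‖) volume x y :=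
    fun x y => (hM x y).norm.const_mul _
  have hu := le_mul_exp_of_le_add_integral (u := fun t => ‖D t‖ * w t) ha
    (fun t => by positivity) (hD.norm.mul hwc) hX (c := δ) fun x hx => ?_
  · calc ‖D X‖ = ‖D X‖ * w X * growth X lam := by rw [mul_assoc, mul_comm (w X), hw, mul_one]
      _ ≤ _ := mul_le_mul_of_nonneg_right hu (growth_pos X lam).le
  · have hDx : ‖D x‖ ≤ (δ + ∫ t in (0 : ℝ)..x, (‖(1 : E)‖ + ‖j‖) * ‖M t‖ * (‖D t‖ * w t))
        * growth x lam := by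
      rw [add_mul]
      exact (propagator_sub_exp_eq hj hM hMj lam x ▸ norm_add_le _ _).trans
        (add_le_add (h x hx)
          (norm_integral_exp_smul_mul_le hj hM hD lam hx.1))
    calc ‖D x‖ * w x ≤ _ := mul_le_mul_of_nonneg_right hDx (hwpos x)
      _ = _ := by rw [mul_assoc, hw, mul_one]

theorem propagator_sub_exp_isLittleO {X : ℝ} (hX : 0 ≤ X) :
    (fun lam => propagator (fun t => M t - lam • j) X - exp (-(lam * X) • j))
      =o[Bornology.cobounded ℂ] growth X := by
  refine isLittleO_iff.2 fun ε hε => ?_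
  set C := Real.exp (∫ t in (0 : ℝ)..X, (‖(1 : E)‖ + ‖j‖) * ‖M t‖)
  have hC : 0 < C := Real.exp_pos _
  obtain ⟨K, hK⟩ := exists_forall_norm_integral_exp_smul_mul_le hj hM hX (div_pos hε hC)
  filter_upwards [tendsto_norm_cobounded_atTop.eventually_ge_atTop K] with lam hlam
  have h := norm_propagator_sub_exp_le hj hM hMj hX (hK lam hlam)
  rwa [div_mul_cancel₀ _ hC.ne', ← norm_growth] at h

theorem propagator_isBigO {X : ℝ} (hX : 0 ≤ X) :
    (fun lam => propagator (fun t => M t - lam • j) X) =O[Bornology.cobounded ℂ] growth X := by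
  have hexp : (fun lam : ℂ => exp (-(lam * X) • j)) =O[Bornology.cobounded ℂ] growth X :=
    .of_bound (‖(1 : E)‖ + ‖j‖) (Eventually.of_forall fun lam => by
      rw [norm_growth, mul_comm _ (growth X lam), growth]
      simpa [abs_mul, abs_of_nonneg hX, mul_comm X] using norm_exp_smul_le hj (-(lam * X)))
  simpa using (propagator_sub_exp_isLittleO hj hM hMj hX).isBigO.add hexp

end Asymptotics
section AntiMultiplicative
open MeasureTheory

variable {E : Type*} [NormedRing E] [NormedAlgebra ℝ E] [CompleteSpace E]

theorem map_propagator_mul_mul_propagator_sub {A : ℝ → E}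
    (hA : ∀ x y, IntervalIntegrable A volume x y) {σ : E →L[ℝ] E}
    (hσ : ∀ a b, σ (a * b) = σ b * σ a) (hσ1 : σ 1 = 1) (C : E) (x : ℝ) :
    σ (propagator A x) * C * propagator A x - C
      = ∫ t in (0 : ℝ)..x,
        σ (propagator A t) * (σ (A t) * C + C * A t) * propagator A t := by
  have hY := isPrimitive_propagator hA
  have h : IsPrimitive (fun t => σ (propagator A t) * C * propagator A t)
      (fun t => σ (propagator A t) * (σ (A t) * C + C * A t) * propagator A t) :=
    (((hY.clm σ).mul (.const C)).mul hY).congr (.of_forall fun t => by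
      simp only [hσ]
      noncomm_ring)
  rw [h.eq_integral x, propagator_zero hA, hσ1, one_mul, mul_one, add_sub_cancel_left]

end AntiMultiplicative

section GramMatrix
open MeasureTheory Set Matrix
open scoped Matrix.Norms.Operator ComplexOrder

/-- The topology of the operator norm, made the default one on matrices: it is the product topology
by definition, but not at the transparency at which instances are compared. -/
@[reducible] noncomputable def normTopology (n : Type*) [Fintype n] :
    TopologicalSpace (Matrix n n ℂ) :=
  (inferInstance : PseudoMetricSpace (Matrix n n ℂ)).toUniformSpace.toTopologicalSpace

attribute [local instance] normTopology

variable {n : Type*} [Fintype n]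

/-- The value `v* M v` of the quadratic form of `M`, as a continuous linear map in `M`. -/
noncomputable def quadraticFormCLM (v : n → ℂ) : Matrix n n ℂ →L[ℝ] ℂ :=
  LinearMap.toContinuousLinearMap
    { toFun := fun M => star v ⬝ᵥ M *ᵥ v
      map_add' := fun A B => by rw [add_mulVec, dotProduct_add]
      map_smul' := fun r A => by rw [smul_mulVec, dotProduct_smul, RingHom.id_apply] }

theorem quadraticFormCLM_apply (v : n → ℂ) (M : Matrix n n ℂ) :
    quadraticFormCLM v M = star v ⬝ᵥ M *ᵥ v :=
  rfl

/-- The conjugate transpose as a continuous real-linear map. -/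
noncomputable def conjTransposeCLM (n : Type*) [Fintype n] : Matrix n n ℂ →L[ℝ] Matrix n n ℂ :=
  LinearMap.toContinuousLinearMap
    { toFun := conjTranspose
      map_add' := conjTranspose_add
      map_smul' := fun r A => by rw [conjTranspose_smul, star_trivial, RingHom.id_apply] }

theorem conjTransposeCLM_apply (M : Matrix n n ℂ) : conjTransposeCLM n M = Mᴴ :=
  rfl

/-- The transpose as a continuous real-linear map. -/
noncomputable def transposeCLM (n : Type*) [Fintype n] : Matrix n n ℂ →L[ℝ] Matrix n n ℂ :=
  LinearMap.toContinuousLinearMap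
    { toFun := transpose
      map_add' := transpose_add
      map_smul' := transpose_smul }

theorem transposeCLM_apply (M : Matrix n n ℂ) : transposeCLM n M = Mᵀ :=
  rfl

theorem continuous_conjTranspose_mul_self {Y : ℝ → Matrix n n ℂ} (hY : Continuous Y) :
    Continuous fun t => (Y t)ᴴ * Y t :=
  ((conjTransposeCLM n).continuous.comp hY).mul hY

theorem posDef_integral_conjTranspose_mul_self [DecidableEq n] {Y : ℝ → Matrix n n ℂ}
    (hY : Continuous Y) (hunit : ∀ t, IsUnit (Y t)) {x : ℝ} (hx : 0 < x) :
    (∫ t in (0 : ℝ)..x, (Y t)ᴴ * Y t).PosDef := by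
  have hcont := continuous_conjTranspose_mul_self hY
  have hint := hcont.intervalIntegrable (μ := volume) 0 x
  refine .of_dotProduct_mulVec_pos ?_ fun v hv => ?_
  · rw [IsHermitian, ← conjTransposeCLM_apply, ← (conjTransposeCLM n).intervalIntegral_comp_comm
      hint]
    exact intervalIntegral.integral_congr fun t _ => isHermitian_conjTranspose_mul_self (Y t)
  · have hpos : ∀ t, 0 < quadraticFormCLM v ((Y t)ᴴ * Y t) := fun t =>
      (PosDef.conjTranspose_mul_self _ (mulVec_injective_of_isUnit (hunit t))).dotProduct_mulVec_pos
        hv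
    have hre : ∀ t, quadraticFormCLM v ((Y t)ᴴ * Y t)
        = ((quadraticFormCLM v ((Y t)ᴴ * Y t)).re : ℂ) := fun t =>
      Complex.eq_re_of_ofReal_le (hpos t).le
    rw [← quadraticFormCLM_apply, ← (quadraticFormCLM v).intervalIntegral_comp_comm hint,
      funext hre, intervalIntegral.integral_ofReal, Complex.zero_lt_real]
    exact intervalIntegral.intervalIntegral_pos_of_pos_on
      ((Complex.continuous_re.comp ((quadraticFormCLM v).continuous.comp hcont)).intervalIntegrable
        0 x) (fun t _ => (Complex.pos_iff.1 (hpos t)).1) hx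

end GramMatrix

section CanonicalSystem
open MeasureTheory Set Matrix
open scoped Matrix.Norms.Operator ComplexOrder ComplexConjugate
attribute [local instance] normTopology

theorem J_mul_J : J * J = -1 := by
  ext i k
  fin_cases i <;> fin_cases k <;> simp [J]

theorem conjTranspose_J : Jᴴ = -J := by
  ext i k
  fin_cases i <;> fin_cases k <;> simp [J]

theorem transpose_mul_J_mul_self (A : Matrix (Fin 2) (Fin 2) ℂ) : Aᵀ * J * A = A.det • J := by
  ext i k
  fin_cases i <;> fin_cases k <;>
    simp [J, mul_apply, Fin.sum_univ_two, det_fin_two] <;> ring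

theorem transpose_mul_J_add_J_mul (A : Matrix (Fin 2) (Fin 2) ℂ) :
    Aᵀ * J + J * A = A.trace • J := by
  ext i k
  fin_cases i <;> fin_cases k <;>
    simp [J, mul_apply, vecMul, dotProduct, Fin.sum_univ_two, trace_fin_two, add_comm]

theorem eq_zero_of_trace_form_eq_zero {a b c d g₁ g₂ g₃ : ℝ} (hdet : a * d - b * c = 1)
    (htr : (a + d) ^ 2 ≤ 4) (hg : 0 < g₁) (hg' : g₂ ^ 2 < g₁ * g₃)
    (h : -b * g₁ + (a - d) * g₂ + c * g₃ = 0) : b = 0 ∧ c = 0 ∧ a = d := by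
  have hg₃ : 0 < g₃ := pos_of_mul_pos_right ((sq_nonneg g₂).trans_lt hg') hg.le
  have hdisc : 0 ≤ -(b * c) - ((a - d) / 2) ^ 2 := by nlinarith
  have hb : b = 0 := by
    have hform : (b * g₁ - (a - d) / 2 * g₂) ^ 2 + ((a - d) / 2) ^ 2 * (g₁ * g₃ - g₂ ^ 2)
        + (-(b * c) - ((a - d) / 2) ^ 2) * (g₁ * g₃) = 0 := by
      linear_combination -b * g₁ * h
    have hdisc_nonneg := mul_nonneg hdisc (mul_pos hg hg₃).le
    have hprod : ((a - d) / 2) ^ 2 * (g₁ * g₃ - g₂ ^ 2) = 0 := by nlinarith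
    have hsq : (b * g₁ - (a - d) / 2 * g₂) ^ 2 = 0 := by nlinarith
    have hp := sq_eq_zero_iff.1 ((mul_eq_zero.1 hprod).resolve_right (sub_pos.2 hg').ne')
    rw [hp, zero_mul, sub_zero, sq_eq_zero_iff] at hsq
    exact (mul_eq_zero.1 hsq).resolve_right hg.ne'
  subst hb
  have had : a = d := by nlinarith [sq_nonneg ((a - d) / 2)]
  subst had
  have hc : c * g₃ = 0 := by linarith
  exact ⟨rfl, (mul_eq_zero.1 hc).resolve_right hg₃.ne', rfl⟩

theorem exists_eq_smul_one_of_trace_mul_J_mul_eq_zero {M G : Matrix (Fin 2) (Fin 2) ℂ}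
    (hM : Mᴴ = Mᵀ) (hdet : M.det = 1) {τ : ℝ} (hτ : τ ^ 2 ≤ 4) (htr : M.trace = τ)
    (hG : G.PosDef) (h : (M * J * G).trace = 0) : ∃ c : ℂ, M = c • 1 := by
  have him : ∀ i k, (M i k).im = 0 := fun i k => Complex.conj_eq_iff_im.1 (congr_fun₂ hM k i)
  have hGim : ∀ i, (G i i).im = 0 := fun i => Complex.conj_eq_iff_im.1 (hG.isHermitian.apply i i)
  have hG10 : G 1 0 = conj (G 0 1) := (hG.isHermitian.apply 1 0).symm
  have hGdet : (G 0 1).re * (G 0 1).re + (G 0 1).im * (G 0 1).im < (G 0 0).re * (G 1 1).re := by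
    simpa [det_fin_two, hG10, hGim] using (Complex.pos_iff.1 hG.det_pos).1
  have hdet_re : (M 0 0).re * (M 1 1).re - (M 0 1).re * (M 1 0).re = 1 := by
    simpa [det_fin_two, him] using congr_arg Complex.re hdet
  have htr_re : (M 0 0).re + (M 1 1).re = τ := by
    simpa [trace_fin_two] using congr_arg Complex.re htr
  have hform : -(M 0 1).re * (G 0 0).re + ((M 0 0).re - (M 1 1).re) * (G 0 1).re
      + (M 1 0).re * (G 1 1).re = 0 := by
    have h_re := congr_arg Complex.re h
    simp only [J, trace_fin_two, mul_apply, of_apply, cons_val', cons_val_fin_one, cons_val_zero,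
      cons_val_one, Fin.sum_univ_two, Fin.isValue, hG10, Complex.add_re, Complex.neg_re,
      Complex.mul_re, Complex.conj_re, Complex.conj_im, Complex.zero_re, him, hGim, mul_zero,
      mul_neg, mul_one, zero_add, neg_mul, add_zero, sub_zero, zero_mul, neg_zero] at h_re
    linarith
  obtain ⟨h01, h10, hdiag⟩ := eq_zero_of_trace_form_eq_zero hdet_re (htr_re ▸ hτ)
    (Complex.pos_iff.1 hG.diag_pos).1 (by nlinarith [sq_nonneg (G 0 1).im]) hform
  refine ⟨M 0 0, ?_⟩
  ext i k
  fin_cases i <;> fin_cases k <;> simp [Complex.ext_iff, h01, h10, hdiag, him]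

/-- A locally integrable potential `P` such that `J Y' + P Y = lam Y` is a Dirac system in canonical
form, that is, a Hermitian `P` with vanishing trace and real off-diagonal part. The last two
conditions are encoded by the vanishing of the anticommutator with `J`. -/
structure IsCanonicalPotential (P : ℝ → Matrix (Fin 2) (Fin 2) ℂ) : Prop where
  intervalIntegrable : ∀ x y, IntervalIntegrable P volume x y
  isHermitian : ∀ t, (P t).IsHermitian
  anticommute : ∀ t, J * P t = -(P t * J)

/-- The fundamental matrix of `J Y' + P Y = lam Y`, normalized at the origin. -/
noncomputable def transferMatrix (P : ℝ → Matrix (Fin 2) (Fin 2) ℂ) (lam : ℂ) :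
    ℝ → Matrix (Fin 2) (Fin 2) ℂ :=
  propagator fun t => J * P t - lam • J

namespace IsCanonicalPotential

variable {P : ℝ → Matrix (Fin 2) (Fin 2) ℂ} (hP : IsCanonicalPotential P)
include hP

theorem intervalIntegrable_J_mul (x y : ℝ) : IntervalIntegrable (fun t => J * P t) volume x y :=
  (hP.intervalIntegrable x y).continuousOn_mul continuousOn_const

theorem intervalIntegrable_coeff (lam : ℂ) (x y : ℝ) :
    IntervalIntegrable (fun t => J * P t - lam • J) volume x y :=
  intervalIntegrable_sub_smul hP.intervalIntegrable_J_mul J lam x y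

theorem continuous_transferMatrix (lam : ℂ) : Continuous (transferMatrix P lam) :=
  continuous_propagator (hP.intervalIntegrable_coeff lam)

theorem isUnit_transferMatrix (lam : ℂ) (x : ℝ) : IsUnit (transferMatrix P lam x) :=
  isUnit_propagator (hP.intervalIntegrable_coeff lam) x

theorem trace_coeff (lam : ℂ) (t : ℝ) : (J * P t - lam • J).trace = 0 := by
  have hJ : J.trace = 0 := by simp [J, trace_fin_two]
  have hJP : (J * P t).trace = -(J * P t).trace := by
    conv_lhs => rw [hP.anticommute t, trace_neg, trace_mul_comm]
  rw [trace_sub, trace_smul, hJ, smul_zero, sub_zero]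
  exact self_eq_neg.1 hJP

theorem transpose_mul_J_mul_transferMatrix (lam : ℂ) (x : ℝ) :
    (transferMatrix P lam x)ᵀ * J * transferMatrix P lam x = J := by
  have h := map_propagator_mul_mul_propagator_sub (hP.intervalIntegrable_coeff lam)
    (σ := transposeCLM (Fin 2)) transpose_mul transpose_one J x
  simpa only [transposeCLM_apply, transpose_mul_J_add_J_mul, hP.trace_coeff, zero_smul, mul_zero,
    zero_mul, intervalIntegral.integral_zero, sub_eq_zero, transferMatrix] using h

theorem det_transferMatrix (lam : ℂ) (x : ℝ) : (transferMatrix P lam x).det = 1 := by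
  have h := hP.transpose_mul_J_mul_transferMatrix lam x
  rw [transpose_mul_J_mul_self] at h
  simpa [J] using congr_fun₂ h 0 1

theorem conjTranspose_coeff (lam : ℂ) (t : ℝ) :
    (J * P t - lam • J)ᴴ * J + J * (J * P t - lam • J) = (lam - conj lam) • 1 := by
  have hJP : (J * P t)ᴴ = J * P t := by
    rw [conjTranspose_mul, hP.isHermitian t, conjTranspose_J, hP.anticommute, mul_neg]
  have hJPJ : J * P t * J = P t := by
    rw [hP.anticommute, neg_mul, mul_assoc, J_mul_J, mul_neg, mul_one, neg_neg]
  rw [conjTranspose_sub, hJP, conjTranspose_smul, conjTranspose_J, sub_mul, mul_sub, hJPJ,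
    ← mul_assoc, mul_smul_comm, smul_mul_assoc, neg_mul, J_mul_J, Complex.star_def,
    neg_one_mul, neg_neg]
  module

theorem conjTranspose_mul_J_mul_transferMatrix_sub (lam : ℂ) (x : ℝ) :
    (transferMatrix P lam x)ᴴ * J * transferMatrix P lam x - J
      = (lam - conj lam) •
        ∫ t in (0 : ℝ)..x, (transferMatrix P lam t)ᴴ * transferMatrix P lam t := by
  have h := map_propagator_mul_mul_propagator_sub (hP.intervalIntegrable_coeff lam)
    (σ := conjTransposeCLM (Fin 2)) conjTranspose_mul conjTranspose_one J x
  simpa only [conjTransposeCLM_apply, hP.conjTranspose_coeff, mul_smul_comm, smul_mul_assoc,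
    mul_one, intervalIntegral.integral_smul, transferMatrix] using h

theorem posDef_integral (lam : ℂ) {x : ℝ} (hx : 0 < x) :
    (∫ t in (0 : ℝ)..x, (transferMatrix P lam t)ᴴ * transferMatrix P lam t).PosDef :=
  posDef_integral_conjTranspose_mul_self (hP.continuous_transferMatrix lam)
    (hP.isUnit_transferMatrix lam) hx

theorem im_eq_zero_of_mulVec_eq_smul {lam ω : ℂ} (hω : ‖ω‖ = 1) {x : ℝ} (hx : 0 < x)
    {v : Fin 2 → ℂ} (hv : v ≠ 0) (h : transferMatrix P lam x *ᵥ v = ω • v) : lam.im = 0 := by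
  have hform : star v ⬝ᵥ ((transferMatrix P lam x)ᴴ * J * transferMatrix P lam x) *ᵥ v
      = star v ⬝ᵥ J *ᵥ v := by
    rw [← mulVec_mulVec, ← mulVec_mulVec, h, dotProduct_mulVec, ← star_mulVec, h, mulVec_smul,
      dotProduct_smul, star_smul, smul_dotProduct, smul_smul, smul_eq_mul, Complex.star_def,
      Complex.mul_conj', hω]
    simp
  have hzero := congr_arg (fun M => star v ⬝ᵥ M *ᵥ v)
    (hP.conjTranspose_mul_J_mul_transferMatrix_sub lam x)
  rw [sub_mulVec, dotProduct_sub, hform, sub_self, smul_mulVec, dotProduct_smul, smul_eq_mul,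
    zero_eq_mul] at hzero
  have hlam := hzero.resolve_right ((hP.posDef_integral lam hx).dotProduct_mulVec_pos hv).ne'
  exact Complex.conj_eq_iff_im.1 (sub_eq_zero.1 hlam).symm

theorem im_eq_zero_of_trace_eq {lam : ℂ} {x : ℝ} (hx : 0 < x) {τ : ℝ} (hτ : τ ^ 2 ≤ 4)
    (htr : (transferMatrix P lam x).trace = τ) : lam.im = 0 := by
  obtain ⟨r, hr⟩ : ∃ r : ℝ, r ^ 2 = 1 - τ ^ 2 / 4 := ⟨√(1 - τ ^ 2 / 4), Real.sq_sqrt (by linarith)⟩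
  set ω : ℂ := ⟨τ / 2, r⟩
  have hω : ‖ω‖ = 1 := by
    rw [← sq_eq_sq₀ (norm_nonneg _) zero_le_one, ← Complex.normSq_eq_norm_sq, Complex.normSq_mk]
    linarith
  have hchar : ω ^ 2 - τ * ω + 1 = 0 := by
    apply Complex.ext <;> simp [ω, sq] <;> linarith
  have hdet : (transferMatrix P lam x - ω • 1).det = 0 := by
    have h1 := hP.det_transferMatrix lam x
    rw [det_fin_two] at h1 ⊢
    rw [trace_fin_two] at htr
    simp
    linear_combination h1 + hchar - ω * htr
  obtain ⟨v, hv, h⟩ := exists_mulVec_eq_zero_iff.2 hdet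
  rw [sub_mulVec, smul_mulVec, one_mulVec, sub_eq_zero] at h
  exact hP.im_eq_zero_of_mulVec_eq_smul hω hx hv h

theorem conjTranspose_eq_transpose {lam : ℂ} (hlam : lam.im = 0) (x : ℝ) :
    (transferMatrix P lam x)ᴴ = (transferMatrix P lam x)ᵀ := by
  have h := hP.conjTranspose_mul_J_mul_transferMatrix_sub lam x
  rw [Complex.conj_eq_iff_im.2 hlam, sub_self, zero_smul, sub_eq_zero] at h
  replace h := h.trans (hP.transpose_mul_J_mul_transferMatrix lam x).symm
  have hJ : IsUnit J := (IsUnit.of_mul_eq_one (-J)) (by rw [mul_neg, J_mul_J, neg_neg])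
  exact hJ.mul_right_cancel ((hP.isUnit_transferMatrix lam x).mul_right_cancel h)

theorem inverse_transferMatrix (lam : ℂ) (x : ℝ) :
    Ring.inverse (transferMatrix P lam x) = -(J * (transferMatrix P lam x)ᵀ * J) := by
  refine (hP.isUnit_transferMatrix lam x).mul_right_cancel ?_
  rw [Ring.inverse_mul_cancel _ (hP.isUnit_transferMatrix lam x), neg_mul, mul_assoc, mul_assoc,
    ← mul_assoc _ J, hP.transpose_mul_J_mul_transferMatrix, J_mul_J, neg_neg]

theorem hasDerivAt_transferMatrix (lam : ℂ) {x : ℝ} (hx : 0 ≤ x) :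
    HasDerivAt (fun μ => transferMatrix P μ x) (transferMatrix P lam x * ∫ t in (0 : ℝ)..x,
      Ring.inverse (transferMatrix P lam t) * -J * transferMatrix P lam t) lam := by
  have hcoeff : ∀ μ : ℂ, transferMatrix P μ = propagator fun t => J * P t + μ • -J := fun μ => by
    simp only [transferMatrix, smul_neg, sub_eq_add_neg]
  have h := hasDerivAt_propagator_add_smul (B := fun _ => -J) hP.intervalIntegrable_J_mul
    (fun _ _ => intervalIntegrable_const) hx lam (hcoeff lam)
  simpa only [← hcoeff] using h

theorem hasDerivAt_transferMatrix_of_im_eq_zero {lam : ℂ} (hlam : lam.im = 0) {x : ℝ}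
    (hx : 0 ≤ x) :
    HasDerivAt (fun μ => transferMatrix P μ x)
      (-(transferMatrix P lam x * J *
        ∫ t in (0 : ℝ)..x, (transferMatrix P lam t)ᴴ * transferMatrix P lam t)) lam := by
  have hgram : ∀ t, Ring.inverse (transferMatrix P lam t) * -J * transferMatrix P lam t
      = -J * ((transferMatrix P lam t)ᴴ * transferMatrix P lam t) := fun t => by
    rw [hP.inverse_transferMatrix, hP.conjTranspose_eq_transpose hlam, neg_mul_neg, mul_assoc _ J J,
      J_mul_J]
    noncomm_ring
  have hint := (ContinuousLinearMap.mul ℝ _ (-J)).intervalIntegral_comp_comm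
    ((continuous_conjTranspose_mul_self (hP.continuous_transferMatrix lam)).intervalIntegrable
      (μ := volume) 0 x)
  simp only [ContinuousLinearMap.mul_apply'] at hint
  refine (hP.hasDerivAt_transferMatrix lam hx).congr_deriv ?_
  simp only [hgram, hint]
  rw [neg_mul, mul_neg, mul_assoc]

theorem exists_transferMatrix_eq_smul_one {lam : ℂ} {x : ℝ} (hx : 0 < x) {τ : ℝ} (hτ : τ ^ 2 ≤ 4)
    (htr : (transferMatrix P lam x).trace = τ)
    (hd : HasDerivAt (fun μ => (transferMatrix P μ x).trace) 0 lam) :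
    ∃ c : ℂ, transferMatrix P lam x = c • 1 := by
  have hlam := hP.im_eq_zero_of_trace_eq hx hτ htr
  have htrace := (LinearMap.toContinuousLinearMap (traceLinearMap (Fin 2) ℂ ℂ)).hasFDerivAt
    |>.comp_hasDerivAt lam (hP.hasDerivAt_transferMatrix_of_im_eq_zero hlam hx.le)
  refine exists_eq_smul_one_of_trace_mul_J_mul_eq_zero (hP.conjTranspose_eq_transpose hlam x)
    (hP.det_transferMatrix lam x) hτ htr (hP.posDef_integral lam hx) ?_
  exact neg_eq_zero.1 ((trace_neg _).symm.trans (htrace.unique hd))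

end IsCanonicalPotential

end CanonicalSystem
section EntireFunctions
open Filter Set Asymptotics Bornology

variable {E : Type*} [NormedAddCommGroup E] [NormedSpace ℂ E]

/-- The filter of neighbourhoods of infinity along the circles `|z| = 2 k`, which stay away from the
zeros `2 k + 1` of `cos (π z / 2)`. -/
noncomputable def circles : Filter ℂ := cobounded ℂ ⊓ 𝓟 {z | ∃ k : ℕ, ‖z‖ = 2 * k}

theorem circles_le_cobounded : circles ≤ cobounded ℂ := inf_le_left

theorem eq_zero_of_tendsto_circles {F : ℂ → E} (hF : Differentiable ℂ F)
    (h : Tendsto F circles (nhds 0)) (z : ℂ) : F z = 0 := by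
  rw [← norm_le_zero_iff]
  refine le_of_forall_pos_le_add fun ε hε => ?_
  rw [zero_add]
  have hsmall := (tendsto_zero_iff_norm_tendsto_zero.1 h).eventually (ge_mem_nhds hε)
  rw [circles, eventually_inf_principal] at hsmall
  obtain ⟨R, -, hR⟩ := (hasBasis_cobounded_norm (E := ℂ)).eventually_iff.1 hsmall
  obtain ⟨k, hk⟩ := exists_nat_gt (max (max R 0) ‖z‖)
  obtain ⟨⟨hRk, hk0⟩, hzk⟩ := (max_lt_iff.1 hk).imp_left max_lt_iff.1
  refine Complex.norm_le_of_forall_mem_frontier_norm_le (Metric.isBounded_ball (x := 0)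
    (r := 2 * k)) hF.diffContOnCl (fun w hw => ?_) (subset_closure ?_)
  · rw [frontier_ball _ (by positivity), mem_sphere_zero_iff_norm] at hw
    exact hR (by rw [mem_ofPred, hw]; linarith) ⟨k, hw⟩
  · rw [mem_ball_zero_iff]
    linarith

theorem eq_zero_of_smul_isLittleO {F : ℂ → E} (hF : Differentiable ℂ F) {W : ℂ → ℂ} {c : ℝ}
    (hW : growth c =O[circles] W) (h : (fun z => W z • F z) =o[circles] growth c) (z : ℂ) :
    F z = 0 := by
  refine eq_zero_of_tendsto_circles hF ((isLittleO_one_iff ℝ).1 ?_) z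
  have hgrowth : (fun z => growth c z • F z) =o[circles] growth c :=
    (hW.smul (isBigO_refl F circles)).trans_isLittleO h
  refine ((isBigO_refl (fun z => (growth c z)⁻¹) circles).smul_isLittleO hgrowth).congr
    (fun z => ?_) fun z => ?_
  · exact inv_smul_smul₀ (growth_pos c z).ne' _
  · exact inv_mul_cancel₀ (growth_pos c z).ne'

theorem eventually_ne_zero_of_growth_isBigO {c : ℝ} {W : ℂ → ℂ} (h : growth c =O[circles] W) :
    ∀ᶠ z in circles, W z ≠ 0 :=
  h.eq_zero_imp.mono fun z hz hW => (growth_pos c z).ne' (hz hW)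

theorem growth_isBigO_of_sub_isLittleO {C W : ℂ → ℂ} {c : ℝ} (hC : growth c =O[circles] C)
    (h : (fun z => W z - C z) =o[circles] growth c) : growth c =O[circles] W :=
  hC.trans (IsEquivalent.isBigO_symm (h.trans_isBigO hC))

theorem exists_mul_eq_of_analyticOrderAt_le {F G : ℂ → ℂ} (hF : Differentiable ℂ F)
    (hG : Differentiable ℂ G) (hG0 : ∀ z, analyticOrderAt G z ≠ ⊤)
    (h : ∀ z, analyticOrderAt G z ≤ analyticOrderAt F z) :
    ∃ H : ℂ → ℂ, Differentiable ℂ H ∧ ∀ z, H z * G z = F z := by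
  have hmero : MeromorphicOn (F / G) univ := fun z _ =>
    (hF.analyticAt z).meromorphicAt.div (hG.analyticAt z).meromorphicAt
  set H := toMeromorphicNFOn (F / G) univ
  have hH : ∀ z, AnalyticAt ℂ H z := fun z => by
    refine (meromorphicNFOn_toMeromorphicNFOn _ _
      (mem_univ z)).meromorphicOrderAt_nonneg_iff_analyticAt.1 ?_
    rw [meromorphicOrderAt_toMeromorphicNFOn hmero (mem_univ z),
      meromorphicOrderAt_div (hF.analyticAt z).meromorphicAt (hG.analyticAt z).meromorphicAt,
      (hF.analyticAt z).meromorphicOrderAt_eq, (hG.analyticAt z).meromorphicOrderAt_eq]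
    have hle := h z
    lift analyticOrderAt G z to ℕ using hG0 z with n
    induction hm : analyticOrderAt F z with
    | top => exact le_top
    | coe m =>
      rw [hm] at hle
      rw [ENat.map_natCast, ENat.map_natCast, ← WithTop.LinearOrderedAddCommGroup.coe_sub]
      exact WithTop.coe_nonneg.2 (sub_nonneg.2 (Int.ofNat_le.2 (ENat.natCast_le_natCast.1 hle)))
  refine ⟨H, fun z => (hH z).differentiableAt, fun z => ?_⟩
  have hG_ne : ∀ᶠ w in nhdsWithin z {z}ᶜ, G w ≠ 0 :=
    (hG.analyticAt z).eventually_eq_zero_or_eventually_ne_zero.resolve_left fun h0 =>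
      hG0 z (analyticOrderAt_eq_top.2 h0)
  refine (((hH z).mul (hG.analyticAt z)).frequently_eq_iff_eventually_eq (hF.analyticAt z)).1
    (Eventually.frequently ?_) |>.self_of_nhds
  filter_upwards [hmero.toMeromorphicNFOn_eq_self_on_nhdsNE (mem_univ z), hG_ne] with w hw hw0
  rw [Pi.mul_apply, show H w = _ from hw, Pi.div_apply, div_mul_cancel₀ _ hw0]

theorem eq_zero_of_onlyDoubleZeros {F G : ℂ → ℂ} (hF : Differentiable ℂ F)
    (hG : Differentiable ℂ G) (hdouble : OnlyDoubleZeros G) (hFG : ∀ z, G z = 0 → F z = 0) {c : ℝ}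
    (hGgrowth : growth (c + c) =O[circles] G) (hFo : F =o[circles] growth c) (z : ℂ) : F z = 0 := by
  have horder : ∀ z, analyticOrderAt G z ≠ ⊤ ∧
      analyticOrderAt G z ≤ analyticOrderAt (F ^ 2) z := fun z => by
    by_cases hz : G z = 0
    · have hF1 : 1 ≤ analyticOrderAt F z :=
        Order.one_le_iff_ne_zero.2 ((hF.analyticAt z).analyticOrderAt_ne_zero.2 (hFG z hz))
      rw [hdouble z hz, analyticOrderAt_pow (hF.analyticAt z), nsmul_eq_mul]
      exact ⟨ENat.natCast_ne_top 2, le_mul_of_one_le_right' hF1⟩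
    · rw [(hG.analyticAt z).analyticOrderAt_eq_zero.2 hz]
      exact ⟨ENat.zero_ne_top, zero_le⟩
  obtain ⟨H, hH, hHG⟩ := exists_mul_eq_of_analyticOrderAt_le (hF.pow 2) hG
    (fun z => (horder z).1) fun z => (horder z).2
  have hsmall : (fun z => G z • H z) =o[circles] growth (c + c) :=
    (hFo.mul hFo).congr (fun z => by rw [smul_eq_mul, mul_comm (G z), hHG, Pi.pow_apply, sq])
      fun z => (growth_add c c z).symm
  have hHz := eq_zero_of_smul_isLittleO hH hGgrowth hsmall z
  rw [← sq_eq_zero_iff, ← Pi.pow_apply, ← hHG, hHz, zero_mul]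

theorem norm_cos_sq (z : ℂ) :
    ‖Complex.cos z‖ ^ 2 = Real.cos z.re ^ 2 + Real.sinh z.im ^ 2 := by
  have h : Complex.cos z = ⟨Real.cos z.re * Real.cosh z.im, -(Real.sin z.re * Real.sinh z.im)⟩ := by
    conv_lhs => rw [← Complex.re_add_im z, Complex.cos_add_mul_I]
    apply Complex.ext <;> simp [← Complex.ofReal_cos, ← Complex.ofReal_cosh, ← Complex.ofReal_sin,
      ← Complex.ofReal_sinh]
  rw [h, ← Complex.normSq_eq_norm_sq, Complex.normSq_mk]
  linear_combination Real.cos z.re ^ 2 * Real.cosh_sq z.im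
    + Real.sinh z.im ^ 2 * Real.sin_sq_add_cos_sq z.re

theorem one_half_le_cos_sq {k : ℕ} {x : ℝ} (hx : |x - k * Real.pi| ≤ Real.pi / 4) :
    1 / 2 ≤ Real.cos x ^ 2 := by
  have hcos : 0 ≤ Real.cos (2 * (x - k * Real.pi)) := by
    rw [abs_le] at hx
    exact Real.cos_nonneg_of_neg_pi_div_two_le_of_le (by linarith) (by linarith)
  rw [show 2 * (x - k * Real.pi) = 2 * x - k * (2 * Real.pi) by ring,
    Real.cos_sub_nat_mul_two_pi, Real.cos_two_mul] at hcos
  linarith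

theorem cosh_sq_le_two_mul_cos_sq_add_sinh_sq {k : ℕ} (hk : 1 ≤ k) {z : ℂ} (hz : ‖z‖ = 2 * k) :
    Real.cosh (Real.pi / 2 * z.im) ^ 2 ≤
      2 * (Real.cos (Real.pi / 2 * z.re) ^ 2 + Real.sinh (Real.pi / 2 * z.im) ^ 2) := by
  have hk' : (1 : ℝ) ≤ k := by exact_mod_cast hk
  rw [Real.cosh_sq]
  rcases le_total 1 |z.im| with him | him
  · have hy : 1 ≤ |Real.pi / 2 * z.im| := by
      rw [abs_mul, abs_of_pos Real.pi_div_two_pos]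
      nlinarith [Real.two_le_pi]
    have hsinh : 1 ≤ Real.sinh (Real.pi / 2 * z.im) ^ 2 := by
      rw [← sq_abs, Real.abs_sinh]
      nlinarith [Real.self_le_sinh_iff.2 (zero_le_one.trans hy)]
    nlinarith [sq_nonneg (Real.cos (Real.pi / 2 * z.re))]
  · have hsq : (2 * k - |z.re|) * (2 * k + |z.re|) = |z.im| ^ 2 := by
      have := Complex.sq_norm_sub_sq_re z
      rw [hz] at this
      rw [sq_abs]
      linear_combination this - sq_abs z.re
    have hre : |z.re| ≤ 2 * k := hz ▸ Complex.abs_re_le_norm z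
    have hclose : 2 * k - |z.re| ≤ 1 / 2 := by
      nlinarith [abs_nonneg z.re, abs_nonneg z.im]
    have hcos : 1 / 2 ≤ Real.cos (Real.pi / 2 * z.re) ^ 2 := by
      rw [← Real.cos_abs, abs_mul, abs_of_pos Real.pi_div_two_pos]
      refine one_half_le_cos_sq (k := k) (abs_le.2 ⟨?_, ?_⟩) <;> nlinarith [Real.pi_pos]
    nlinarith [sq_nonneg (Real.sinh (Real.pi / 2 * z.im))]

theorem growth_le_norm_cos {k : ℕ} (hk : 1 ≤ k) {z : ℂ} (hz : ‖z‖ = 2 * k) :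
    growth (Real.pi / 2) z ≤ 3 * ‖Complex.cos ((Real.pi / 2 : ℝ) * z)‖ := by
  have hbound := cosh_sq_le_two_mul_cos_sq_add_sinh_sq hk hz
  have hnorm := norm_cos_sq ((Real.pi / 2 : ℝ) * z)
  rw [Complex.re_ofReal_mul, Complex.im_ofReal_mul] at hnorm
  have hexp : growth (Real.pi / 2) z ≤ 2 * Real.cosh (Real.pi / 2 * z.im) := by
    rw [growth, ← Real.cosh_abs, abs_mul, abs_of_pos Real.pi_div_two_pos, Real.cosh_eq]
    linarith [Real.exp_pos (-(Real.pi / 2 * |z.im|))]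
  refine hexp.trans (abs_le_of_sq_le_sq' ?_ (by positivity)).2
  nlinarith

theorem growth_isBigO_cos :
    growth (Real.pi / 2) =O[circles] fun z => Complex.cos ((Real.pi / 2 : ℝ) * z) := by
  refine .of_bound 3 ?_
  rw [circles, eventually_inf_principal]
  filter_upwards [(hasBasis_cobounded_norm (E := ℂ)).mem_of_mem (i := 1) trivial] with z hz hk
  obtain ⟨k, hk⟩ := hk
  rw [norm_growth]
  refine growth_le_norm_cos (Nat.one_le_iff_ne_zero.2 ?_) hk
  rintro rfl
  norm_num [show ‖z‖ = _ from hk] at hz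

theorem onlyDoubleZeros_const_mul_comp_sub_iff {g : ℂ → ℂ} (hg : Differentiable ℂ g) {c : ℂ}
    (hc : c ≠ 0) (a : ℂ) : OnlyDoubleZeros (fun z => c * g (z - a)) ↔ OnlyDoubleZeros g := by
  have horder (z : ℂ) :
      analyticOrderAt (fun z => c * g (z - a)) z = analyticOrderAt g (z - a) := by
    have hsub : AnalyticAt ℂ (fun z : ℂ => z - a) z := by fun_prop
    have hcomp : AnalyticAt ℂ (g ∘ fun z => z - a) z := (hg.analyticAt _).comp hsub
    calc analyticOrderAt (fun z => c * g (z - a)) z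
        = analyticOrderAt (fun _ => c) z + analyticOrderAt (g ∘ fun z => z - a) z :=
          analyticOrderAt_mul analyticAt_const hcomp
      _ = analyticOrderAt g (z - a) := by
          rw [analyticAt_const.analyticOrderAt_eq_zero.2 hc, zero_add,
            analyticOrderAt_comp_of_deriv_ne_zero hsub (by simp)]
  refine ⟨fun h z hz => ?_, fun h z hz => ?_⟩
  · have hz' := horder (z + a)
    rw [add_sub_cancel_right] at hz'
    rw [← hz']
    refine h _ ?_
    simp only [add_sub_cancel_right, hz, mul_zero]
  · rw [horder]
    exact h _ ((mul_eq_zero.1 hz).resolve_left hc)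

end EntireFunctions
section TwoByTwo
open Matrix
open scoped Matrix.Norms.Operator
attribute [local instance] normTopology

theorem trace_mul_self_add_two_mul_det (A : Matrix (Fin 2) (Fin 2) ℂ) :
    (A * A).trace + 2 * A.det = A.trace ^ 2 := by
  simp only [trace_fin_two, det_fin_two, mul_apply, Fin.sum_univ_two]
  ring

/-- The adjugate of a `2 × 2` matrix, which depends linearly on the matrix. -/
noncomputable def adjugateCLM : Matrix (Fin 2) (Fin 2) ℂ →L[ℂ] Matrix (Fin 2) (Fin 2) ℂ :=
  LinearMap.toContinuousLinearMap ((traceLinearMap (Fin 2) ℂ ℂ).smulRight 1 - LinearMap.id)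

theorem adjugateCLM_apply (A : Matrix (Fin 2) (Fin 2) ℂ) : adjugateCLM A = A.trace • 1 - A := rfl

theorem inv_eq_adjugateCLM {A : Matrix (Fin 2) (Fin 2) ℂ} (hA : A.det = 1) :
    A⁻¹ = adjugateCLM A := by
  rw [inv_def, hA, Ring.inverse_one, one_smul, adjugate_fin_two, adjugateCLM_apply]
  ext i k
  fin_cases i <;> fin_cases k <;> simp [trace_fin_two]

theorem eq_or_mul_eq_neg_one {A B : Matrix (Fin 2) (Fin 2) ℂ} (hA : A.det = 1) (hB : B.det = 1)
    {c : ℂ} (h : A = B + c • 1) : A = B ∨ B * A = -1 := by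
  have hc : c * (c + B.trace) = 0 := by
    have hdet : (B + c • 1).det = B.det + c * (c + B.trace) := by
      simp [det_fin_two, trace_fin_two]
      ring
    rwa [← h, hA, hB, left_eq_add] at hdet
  rcases mul_eq_zero.1 hc with hc | hc
  · left
    rw [h, hc, zero_smul, add_zero]
  · right
    have hinv : A = -B⁻¹ := by
      rw [h, eq_neg_of_add_eq_zero_left hc, inv_eq_adjugateCLM hB, adjugateCLM_apply, neg_smul,
        neg_sub, sub_eq_add_neg]
    rw [hinv, mul_neg, mul_nonsing_inv _ (hB ▸ isUnit_one)]

theorem trace_smul_mul_inv_sub_one {A A' B B' : Matrix (Fin 2) (Fin 2) ℂ} (hA' : A'.det = 1)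
    (hB : B.det = 1) (hB' : B'.det = 1) (h : B * A = B' * A') :
    (B' * A').trace • (A * A'⁻¹ - 1) = (A - A') * B' + (B⁻¹ - B'⁻¹) * A'⁻¹ := by
  have hW : (B' * A').trace • (1 : Matrix (Fin 2) (Fin 2) ℂ) = A' * B' + B'⁻¹ * A'⁻¹ := by
    rw [← Matrix.mul_inv_rev, inv_eq_adjugateCLM (by rw [det_mul, hA', hB', one_mul]),
      adjugateCLM_apply,
      trace_mul_comm, add_sub_cancel]
  have hcancel : A * A'⁻¹ = B⁻¹ * B' := by
    rw [← nonsing_inv_mul_cancel_left (A := B) A (hB ▸ isUnit_one), h, mul_assoc, mul_assoc,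
      mul_nonsing_inv _ (hA' ▸ isUnit_one), mul_one]
  calc (B' * A').trace • (A * A'⁻¹ - 1)
      = (A * A'⁻¹ - 1) * (A' * B' + B'⁻¹ * A'⁻¹) := by rw [← hW, mul_smul_comm, mul_one]
    _ = (A * A'⁻¹ - 1) * (A' * B') + (B⁻¹ * B' - 1) * (B'⁻¹ * A'⁻¹) := by rw [mul_add, hcancel]
    _ = (A - A') * B' + (B⁻¹ - B'⁻¹) * A'⁻¹ := by
      rw [sub_mul, sub_mul, sub_mul, sub_mul, one_mul, one_mul, ← mul_assoc, mul_assoc A,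
        nonsing_inv_mul _ (hA' ▸ isUnit_one), mul_one, ← mul_assoc, mul_assoc B⁻¹,
        mul_nonsing_inv _ (hB' ▸ isUnit_one), mul_one]

end TwoByTwo

section InverseProblem
open MeasureTheory Filter Set Asymptotics Bornology Matrix
open scoped Matrix.Norms.Operator
attribute [local instance] normTopology

namespace IsCanonicalPotential

variable {P P' : ℝ → Matrix (Fin 2) (Fin 2) ℂ} (hP : IsCanonicalPotential P)
include hP

theorem translate (s : ℝ) : IsCanonicalPotential fun t => P (s + t) where
  intervalIntegrable x y := by
    simpa using (hP.intervalIntegrable (s + x) (s + y)).comp_add_left (c := s)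
  isHermitian t := hP.isHermitian (s + t)
  anticommute t := hP.anticommute (s + t)

theorem transferMatrix_add (lam : ℂ) (s t : ℝ) :
    transferMatrix P lam (s + t)
      = transferMatrix (fun r => P (s + r)) lam t * transferMatrix P lam s :=
  propagator_add_time (hP.intervalIntegrable_coeff lam) s t

theorem transferMatrix_congr (h : P =ᵐ[volume] P') : transferMatrix P' = transferMatrix P := by
  funext lam
  refine propagator_congr (hP.intervalIntegrable_coeff lam) ?_
  filter_upwards [h] with t ht
  rw [ht]

theorem differentiable_transferMatrix {x : ℝ} (hx : 0 ≤ x) :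
    Differentiable ℂ fun lam => transferMatrix P lam x :=
  fun lam => (hP.hasDerivAt_transferMatrix lam hx).differentiableAt

theorem inv_transferMatrix (lam : ℂ) (x : ℝ) :
    (transferMatrix P lam x)⁻¹ = adjugateCLM (transferMatrix P lam x) :=
  inv_eq_adjugateCLM (hP.det_transferMatrix lam x)

theorem differentiable_inv_transferMatrix {x : ℝ} (hx : 0 ≤ x) :
    Differentiable ℂ fun lam => (transferMatrix P lam x)⁻¹ := by
  simp only [hP.inv_transferMatrix]
  exact adjugateCLM.differentiable.comp (hP.differentiable_transferMatrix hx)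

theorem differentiable_trace_transferMatrix {x : ℝ} (hx : 0 ≤ x) :
    Differentiable ℂ fun lam => (transferMatrix P lam x).trace :=
  (LinearMap.toContinuousLinearMap (traceLinearMap (Fin 2) ℂ ℂ)).differentiable.comp
    (hP.differentiable_transferMatrix hx)

theorem J_mul_J_mul (t : ℝ) : J * (J * P t) = -(J * P t * J) := by
  rw [mul_assoc, ← mul_neg, ← hP.anticommute]

theorem transferMatrix_isBigO {x : ℝ} (hx : 0 ≤ x) :
    (fun lam => transferMatrix P lam x) =O[circles] growth x :=
  (propagator_isBigO J_mul_J hP.intervalIntegrable_J_mul hP.J_mul_J_mul hx).mono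
    circles_le_cobounded

theorem inv_transferMatrix_isBigO {x : ℝ} (hx : 0 ≤ x) :
    (fun lam => (transferMatrix P lam x)⁻¹) =O[circles] growth x := by
  simp only [hP.inv_transferMatrix]
  exact (adjugateCLM.isBigO_comp _ _).trans (hP.transferMatrix_isBigO hx)

theorem transferMatrix_sub_exp_isLittleO {x : ℝ} (hx : 0 ≤ x) :
    (fun lam => transferMatrix P lam x - NormedSpace.exp (-(lam * x) • J)) =o[circles] growth x :=
  (propagator_sub_exp_isLittleO J_mul_J hP.intervalIntegrable_J_mul hP.J_mul_J_mul hx).mono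
    circles_le_cobounded

theorem transferMatrix_sub_isLittleO (hP' : IsCanonicalPotential P') {x : ℝ} (hx : 0 ≤ x) :
    (fun lam => transferMatrix P lam x - transferMatrix P' lam x) =o[circles] growth x :=
  ((hP.transferMatrix_sub_exp_isLittleO hx).sub
    (hP'.transferMatrix_sub_exp_isLittleO hx)).congr_left fun _ => sub_sub_sub_cancel_right _ _ _

theorem inv_transferMatrix_sub_isLittleO (hP' : IsCanonicalPotential P') {x : ℝ} (hx : 0 ≤ x) :
    (fun lam => (transferMatrix P lam x)⁻¹ - (transferMatrix P' lam x)⁻¹) =o[circles]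
      growth x := by
  simp only [hP.inv_transferMatrix, hP'.inv_transferMatrix, ← map_sub]
  exact (adjugateCLM.isBigO_comp _ _).trans_isLittleO (hP.transferMatrix_sub_isLittleO hP' hx)

theorem trace_transferMatrix_sub_isLittleO {x : ℝ} (hx : 0 ≤ x) :
    (fun lam => (transferMatrix P lam x).trace - 2 * Complex.cos (x * lam)) =o[circles]
      growth x := by
  have htrace : ∀ lam : ℂ, (NormedSpace.exp (-(lam * x) • J)).trace = 2 * Complex.cos (x * lam) :=
    fun lam => by
      have hJ : J.trace = 0 := by simp [J, trace_fin_two]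
      rw [exp_smul_of_mul_self_eq_neg_one J_mul_J, trace_add, trace_smul, trace_smul, hJ,
        trace_one, Complex.cos_neg, mul_comm lam]
      simp [mul_comm]
  simp only [← htrace, ← trace_sub]
  exact ((LinearMap.toContinuousLinearMap (traceLinearMap (Fin 2) ℂ ℂ)).isBigO_comp _ _
    ).trans_isLittleO (hP.transferMatrix_sub_exp_isLittleO hx)

theorem growth_isBigO_trace_transferMatrix :
    growth (Real.pi / 2) =O[circles] fun lam => (transferMatrix P lam (Real.pi / 2)).trace :=
  growth_isBigO_of_sub_isLittleO (growth_isBigO_cos.trans (isBigO_self_const_mul two_ne_zero _ _))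
    (hP.trace_transferMatrix_sub_isLittleO Real.pi_div_two_pos.le)

theorem growth_isBigO_trace_transferMatrix_add_two :
    growth (Real.pi / 2 + Real.pi / 2) =O[circles]
      fun lam => (transferMatrix P lam (Real.pi / 2 + Real.pi / 2)).trace + 2 := by
  have hcos := (growth_isBigO_cos.mul growth_isBigO_cos).congr_left fun z =>
    (growth_add (Real.pi / 2) (Real.pi / 2) z).symm
  refine growth_isBigO_of_sub_isLittleO
    (hcos.trans (isBigO_self_const_mul (show (4 : ℂ) ≠ 0 by norm_num) _ _))
    ((hP.trace_transferMatrix_sub_isLittleO (by positivity)).congr_left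
      fun lam => ?_)
  rw [Complex.ofReal_add, add_mul, ← two_mul (_ * lam), Complex.cos_two_mul]
  ring

theorem deriv_trace_transferMatrix_ne_zero {lam : ℂ} {x : ℝ} (hx : 0 < x)
    (h : (transferMatrix P lam x).trace = 0) :
    deriv (fun μ => (transferMatrix P μ x).trace) lam ≠ 0 := fun hd => by
  obtain ⟨c, hc⟩ := hP.exists_transferMatrix_eq_smul_one hx (τ := 0) (by norm_num)
    (by rw [h, Complex.ofReal_zero])
    (hd ▸ (hP.differentiable_trace_transferMatrix hx.le lam).hasDerivAt)
  have hdet := hP.det_transferMatrix lam x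
  rw [hc, trace_smul, trace_one, smul_eq_mul, mul_eq_zero] at h
  rw [hc, h.resolve_right (by simp), zero_smul, det_zero] at hdet
  exact zero_ne_one hdet

theorem onlyDoubleZeros_trace_add_two {x : ℝ} (hx : 0 < x)
    (hper : P =ᵐ[volume] fun t => P (x + t)) :
    OnlyDoubleZeros fun lam => (transferMatrix P lam (x + x)).trace + 2 := fun lam h0 => by
  have hsq : (fun lam => (transferMatrix P lam (x + x)).trace + 2)
      = (fun lam => (transferMatrix P lam x).trace) ^ 2 := funext fun μ => by
    rw [hP.transferMatrix_add, hP.transferMatrix_congr hper, Pi.pow_apply,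
      ← trace_mul_self_add_two_mul_det, hP.det_transferMatrix, mul_one]
  have htr : (transferMatrix P lam x).trace = 0 :=
    sq_eq_zero_iff.1 ((congr_fun hsq lam).symm.trans h0)
  have han := (hP.differentiable_trace_transferMatrix hx.le).analyticAt lam
  rw [hsq, analyticOrderAt_pow han, han.analyticOrderAt_eq_one_of_zero_deriv_ne_zero htr
    (hP.deriv_trace_transferMatrix_ne_zero hx htr), nsmul_one, Nat.cast_ofNat]

theorem transferMatrix_eq_neg_one_of_analyticOrderAt_eq_two {lam : ℂ} {x : ℝ} (hx : 0 < x)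
    (h0 : (transferMatrix P lam x).trace + 2 = 0)
    (h : analyticOrderAt (fun μ => (transferMatrix P μ x).trace + 2) lam = 2) :
    transferMatrix P lam x = -1 := by
  have hdiff := (hP.differentiable_trace_transferMatrix hx.le).add_const (2 : ℂ)
  have hderiv : deriv (fun μ => (transferMatrix P μ x).trace + 2) lam = 0 := by
    by_contra hne
    have hone := (hdiff.analyticAt lam).analyticOrderAt_eq_one_of_zero_deriv_ne_zero h0 hne
    exact absurd (hone.symm.trans h) (by decide)
  rw [deriv_add_const] at hderiv
  obtain ⟨c, hc⟩ := hP.exists_transferMatrix_eq_smul_one hx (τ := -2) (by norm_num)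
    (by rw [eq_neg_of_add_eq_zero_left h0]; norm_num)
    (hderiv ▸ (hP.differentiable_trace_transferMatrix hx.le lam).hasDerivAt)
  rw [hc, trace_smul, trace_one, Fintype.card_fin, smul_eq_mul] at h0
  rw [hc, show c = -1 by push_cast at h0; linear_combination h0 / 2, neg_one_smul]

theorem transferMatrix_eq_of_eventuallyEq (hP' : IsCanonicalPotential P')
    (h : ∀ᶠ lam in circles,
      transferMatrix P lam (Real.pi / 2) = transferMatrix P' lam (Real.pi / 2))
    {x : ℝ} (hx : x ∈ Icc 0 (Real.pi / 2)) (lam : ℂ) :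
    transferMatrix P lam x = transferMatrix P' lam x := by
  set y := Real.pi / 2 - x with hy
  have hy0 : 0 ≤ y := sub_nonneg.2 hx.2
  have hxy : x + y = Real.pi / 2 := add_sub_cancel _ _
  rw [← hxy] at h
  have hgrowth : ∀ μ, growth x μ * growth y μ = growth (Real.pi / 2) μ := fun μ => by
    rw [← hxy, growth_add]
  have hidentity : ∀ᶠ μ in circles, (transferMatrix P' μ (Real.pi / 2)).trace •
      (transferMatrix P μ x * (transferMatrix P' μ x)⁻¹ - 1)
      = (transferMatrix P μ x - transferMatrix P' μ x) *
          transferMatrix (fun r => P' (x + r)) μ y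
        + ((transferMatrix (fun r => P (x + r)) μ y)⁻¹
          - (transferMatrix (fun r => P' (x + r)) μ y)⁻¹) * (transferMatrix P' μ x)⁻¹ := by
    filter_upwards [h] with μ hμ
    rw [hP.transferMatrix_add, hP'.transferMatrix_add] at hμ
    rw [← hxy, hP'.transferMatrix_add]
    exact trace_smul_mul_inv_sub_one (hP'.det_transferMatrix μ x)
      ((hP.translate x).det_transferMatrix μ y) ((hP'.translate x).det_transferMatrix μ y) hμ
  have hsmall : (fun μ => (transferMatrix P' μ (Real.pi / 2)).trace •
      (transferMatrix P μ x * (transferMatrix P' μ x)⁻¹ - 1)) =o[circles]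
        growth (Real.pi / 2) := by
    refine IsLittleO.congr' (.add ?_ ?_) (hidentity.mono fun _ => Eq.symm) .rfl
    · exact ((hP.transferMatrix_sub_isLittleO hP' hx.1).mul_isBigO
        ((hP'.translate x).transferMatrix_isBigO hy0)).congr_right hgrowth
    · exact (((hP.translate x).inv_transferMatrix_sub_isLittleO (hP'.translate x) hy0).mul_isBigO
        (hP'.inv_transferMatrix_isBigO hx.1)).congr_right fun μ => by rw [mul_comm, hgrowth]
  have hone := eq_zero_of_smul_isLittleO (((hP.differentiable_transferMatrix hx.1).mul
    (hP'.differentiable_inv_transferMatrix hx.1)).sub_const 1)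
    hP'.growth_isBigO_trace_transferMatrix hsmall lam
  rw [← nonsing_inv_mul_cancel_right (A := transferMatrix P' lam x) (transferMatrix P lam x)
    (hP'.det_transferMatrix lam x ▸ isUnit_one),
    show transferMatrix P lam x * _ = 1 from sub_eq_zero.1 hone, one_mul]

theorem ae_eq_of_transferMatrix_eq (hP' : IsCanonicalPotential P') {lam : ℂ} {X : ℝ}
    (h : ∀ x ∈ Ioo 0 X, transferMatrix P lam x = transferMatrix P' lam x) :
    ∀ᵐ t, t ∈ Ioo 0 X → P t = P' t := by
  have hJ : IsUnit J := IsUnit.of_mul_eq_one (-J) (by rw [mul_neg, J_mul_J, neg_neg])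
  filter_upwards [ae_eq_of_propagator_eq (hP.intervalIntegrable_coeff lam)
    (hP'.intervalIntegrable_coeff lam) h] with t ht htX
  exact hJ.mul_left_cancel (sub_left_injective (ht htX))

theorem exists_transferMatrix_eq_add_smul_one
    (h : OnlyDoubleZeros fun lam => (transferMatrix P lam (Real.pi / 2 + Real.pi / 2)).trace + 2)
    (lam : ℂ) : ∃ c : ℂ, transferMatrix P lam (Real.pi / 2)
      = transferMatrix (fun t => P (Real.pi / 2 + t)) lam (Real.pi / 2) + c • 1 := by
  have hx := Real.pi_div_two_pos
  have hP' := hP.translate (Real.pi / 2)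
  set P' := fun t => P (Real.pi / 2 + t)
  have hzero : ∀ (L : Matrix (Fin 2) (Fin 2) ℂ →ₗ[ℂ] ℂ), L 1 = 0 → ∀ μ,
      L (transferMatrix P μ (Real.pi / 2) - transferMatrix P' μ (Real.pi / 2)) = 0 := by
    refine fun L hL => eq_zero_of_onlyDoubleZeros
      ((LinearMap.toContinuousLinearMap L).differentiable.comp
        ((hP.differentiable_transferMatrix hx.le).sub (hP'.differentiable_transferMatrix hx.le)))
      ((hP.differentiable_trace_transferMatrix (add_pos hx hx).le).add_const 2) h
      (fun μ hμ => ?_) hP.growth_isBigO_trace_transferMatrix_add_two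
      (((LinearMap.toContinuousLinearMap L).isBigO_comp _ _).trans_isLittleO
        (hP.transferMatrix_sub_isLittleO hP' hx.le))
    have hmul := hP.transferMatrix_eq_neg_one_of_analyticOrderAt_eq_two (add_pos hx hx) hμ (h μ hμ)
    rw [hP.transferMatrix_add] at hmul
    have hinv : transferMatrix P μ (Real.pi / 2) = -(transferMatrix P' μ (Real.pi / 2))⁻¹ := by
      rw [← nonsing_inv_mul_cancel_left (A := transferMatrix P' μ (Real.pi / 2))
        (transferMatrix P μ (Real.pi / 2)) (hP'.det_transferMatrix μ _ ▸ isUnit_one), hmul,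
        mul_neg, mul_one]
    rw [hinv, hP'.inv_transferMatrix, adjugateCLM_apply, neg_sub, sub_sub_cancel_left, map_neg,
      map_smul, hL, smul_zero, neg_zero]
  obtain ⟨c, hc⟩ := Submodule.mem_span_singleton.1
    ((Subspace.forall_mem_dualAnnihilator_apply_eq_zero_iff (ℂ ∙ 1) _).1 fun L hL =>
      hzero L ((Submodule.mem_dualAnnihilator L).1 hL 1 (Submodule.mem_span_singleton_self 1)) lam)
  exact ⟨c, by rw [hc, add_sub_cancel]⟩

theorem ae_eq_translate_of_onlyDoubleZeros
    (h : OnlyDoubleZeros fun lam => (transferMatrix P lam (Real.pi / 2 + Real.pi / 2)).trace + 2) :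
    ∀ᵐ t, t ∈ Ioo 0 (Real.pi / 2) → P t = P (Real.pi / 2 + t) := by
  have hP' := hP.translate (Real.pi / 2)
  refine hP.ae_eq_of_transferMatrix_eq hP' (lam := 0) fun x hx =>
    hP.transferMatrix_eq_of_eventuallyEq hP' ?_ (Ioo_subset_Icc_self hx) 0
  filter_upwards [eventually_ne_zero_of_growth_isBigO
    hP.growth_isBigO_trace_transferMatrix_add_two] with lam hlam
  obtain ⟨c, hc⟩ := hP.exists_transferMatrix_eq_add_smul_one h lam
  refine (eq_or_mul_eq_neg_one (hP.det_transferMatrix lam _) (hP'.det_transferMatrix lam _)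
    hc).resolve_right fun hmul => hlam ?_
  rw [hP.transferMatrix_add, hmul]
  simp

end IsCanonicalPotential
end InverseProblem
section Entries
open MeasureTheory Set Matrix
open scoped Matrix.Norms.Operator
attribute [local instance] normTopology

variable {n : Type*} [Fintype n] {M : ℝ → Matrix n n ℂ}

/-- The `(i, k)` entry as a continuous real-linear map. -/
noncomputable def entryCLM (i k : n) : Matrix n n ℂ →L[ℝ] ℂ :=
  LinearMap.toContinuousLinearMap (entryLinearMap ℝ ℂ i k)

theorem entryCLM_apply (i k : n) (A : Matrix n n ℂ) : entryCLM i k A = A i k :=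
  rfl

theorem intervalIntegrable_entry {x y : ℝ} (hM : IntervalIntegrable M volume x y) (i k : n) :
    IntervalIntegrable (fun t => M t i k) volume x y :=
  ⟨(entryCLM i k).integrable_comp hM.1, (entryCLM i k).integrable_comp hM.2⟩

theorem intervalIntegrable_of_entries {x y : ℝ}
    (hM : ∀ i k, IntervalIntegrable (fun t => M t i k) volume x y) :
    IntervalIntegrable M volume x y := by
  classical
  have hsingle : ∀ i k, IntervalIntegrable (fun t => M t i k • single i k (1 : ℂ)) volume x y :=
    fun i k => (hM i k).smul_continuousOn continuousOn_const
  have hsum : M = ∑ i, ∑ k, fun t => M t i k • single i k (1 : ℂ) := by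
    funext t
    conv_lhs => rw [matrix_eq_sum_single (M t)]
    simp only [Finset.sum_apply, smul_single, smul_eq_mul, mul_one]
  rw [hsum]
  exact IntervalIntegrable.sum _ fun i _ => IntervalIntegrable.sum _ fun k _ => hsingle i k

theorem IsPrimitive.of_entries {F f : ℝ → Matrix n n ℂ}
    (h : ∀ i k, IsPrimitive (fun x => F x i k) (fun x => f x i k)) : IsPrimitive F f where
  intervalIntegrable x y := intervalIntegrable_of_entries fun i k => (h i k).intervalIntegrable x y
  eq_integral x := by
    ext i k
    have hcomm := (entryCLM i k).intervalIntegral_comp_comm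
      (intervalIntegrable_of_entries fun i k => (h i k).intervalIntegrable 0 x)
    simp only [entryCLM_apply] at hcomm
    rw [Matrix.add_apply, ← hcomm]
    exact (h i k).eq_integral x

end Entries

section Gauge
open MeasureTheory Set Filter Matrix
open scoped Matrix.Norms.Operator
attribute [local instance] normTopology

variable {Q : ℝ → Matrix (Fin 2) (Fin 2) ℂ}

theorem intervalIntegrable_of_periodic (hper : Function.Periodic Q Real.pi)
    (hint : ∀ i j, IntegrableOn (fun z => Q z i j) (Ico 0 Real.pi)) (x y : ℝ) :
    IntervalIntegrable Q volume x y :=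
  intervalIntegrable_of_entries fun i j =>
    Function.Periodic.intervalIntegrable₀ (f := fun z => Q z i j) (fun z => congr_fun₂ (hper z) i j)
      Real.pi_ne_zero
      ((intervalIntegrable_iff_integrableOn_Ico_of_le Real.pi_pos.le).2 (hint i j)) x y

theorem IsFundamentalMatrix.isPrimitive (hQ : ∀ x y, IntervalIntegrable Q volume x y)
    {lam : ℂ} {Y : ℝ → Matrix (Fin 2) (Fin 2) ℂ} (hY : IsFundamentalMatrix Q lam Y) :
    IsPrimitive Y (fun t => J * (Q t - lam • 1) * Y t) := by
  have hcont : Continuous Y := by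
    refine continuous_matrix fun i k => continuous_iff_continuousAt.2 fun x => ?_
    exact (hY.absolutelyContinuous i k (x - 1) (x + 1)).continuousOn.continuousAt
      (by rw [uIcc_of_le (by linarith)]; exact Icc_mem_nhds (by linarith) (by linarith))
  refine .of_entries fun i k => .of_absolutelyContinuous
    (fun x y => intervalIntegrable_entry ((((hQ x y).sub intervalIntegrable_const).continuousOn_mul
      continuousOn_const).mul_continuousOn hcont.continuousOn) i k) (hY.absolutelyContinuous i k) ?_
  filter_upwards [hY.equation] with z ⟨Y', hderiv, heq⟩
  have hY' : Y' = J * (Q z - lam • 1) * Y z := by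
    rw [mul_assoc, sub_mul, smul_mul_assoc, one_mul, ← heq, sub_add_cancel_right, mul_neg,
      ← mul_assoc, J_mul_J, neg_mul, one_mul, neg_neg]
  exact hY' ▸ hderiv i k

theorem J_mul_Q1 (Q : ℝ → Matrix (Fin 2) (Fin 2) ℂ) (z : ℝ) : J * Q1 Q z = -(Q1 Q z * J) := by
  ext i k
  fin_cases i <;> fin_cases k <;> simp [J, Q1, sigma1, sigma3]

/-- Half the trace of `Q`, the coefficient of the identity in `Q2 Q`. -/
noncomputable def halfTrace (Q : ℝ → Matrix (Fin 2) (Fin 2) ℂ) (t : ℝ) : ℝ :=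
  (Q t).trace.re / 2

/-- The mean value of `halfTrace Q` over the period `π`. -/
noncomputable def meanHalfTrace (Q : ℝ → Matrix (Fin 2) (Fin 2) ℂ) : ℝ :=
  ⨍ t in (0 : ℝ)..Real.pi, halfTrace Q t

/-- The rotation angle of the gauge matrix, which is a scalar multiple of
`exp (angle Q x • J)`. -/
noncomputable def angle (Q : ℝ → Matrix (Fin 2) (Fin 2) ℂ) (x : ℝ) : ℝ :=
  ∫ t in (0 : ℝ)..x, (halfTrace Q t - meanHalfTrace Q)

theorem Q2_eq (hherm : ∀ z, (Q z).IsHermitian) (z : ℝ) :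
    Q2 Q z = (halfTrace Q z : ℂ) • 1 + ((Q z 0 1).im : ℂ) • sigma2 := by
  have htrace : ((Q z).trace.re : ℂ) = (Q z).trace := by
    rw [← Complex.conj_eq_iff_re, ← Complex.star_def, ← trace_conjTranspose, (hherm z).eq]
  rw [Q2, halfTrace, Complex.ofReal_div, htrace, trace_fin_two, Complex.ofReal_ofNat]

theorem Q1_add_Q2 (hherm : ∀ z, (Q z).IsHermitian) (z : ℝ) : Q1 Q z + Q2 Q z = Q z := by
  have h10 : Q z 1 0 = star (Q z 0 1) := ((hherm z).apply 1 0).symm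
  ext i k
  fin_cases i <;> fin_cases k <;>
    simp [Q1, Q2, sigma1, sigma2, sigma3, h10, Complex.ext_iff] <;> ring_nf <;> simp

theorem J_mul_exp_smul_J (a : ℂ) :
    J * NormedSpace.exp (a • J) = NormedSpace.exp (a • J) * J :=
  ((Commute.refl J).smul_right a).exp_right

theorem sigma2_eq : sigma2 = Complex.I • J := by
  ext i k
  fin_cases i <;> fin_cases k <;> simp [J, sigma2]

theorem J_mul_Q2 (hherm : ∀ z, (Q z).IsHermitian) (z : ℝ) :
    J * Q2 Q z = (halfTrace Q z : ℂ) • J - ((Q z 0 1).im : ℂ) • Complex.I • 1 := by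
  rw [Q2_eq hherm, sigma2_eq, mul_add, mul_smul_comm, mul_one, mul_smul_comm, mul_smul_comm,
    J_mul_J, smul_neg, smul_neg, sub_eq_add_neg]

theorem Q1_eq (hherm : ∀ z, (Q z).IsHermitian) (z : ℝ) :
    Q1 Q z = (2⁻¹ : ℂ) • (Q z + J * Q z * J) := by
  have hQ1 : J * Q1 Q z * J = Q1 Q z := by
    rw [J_mul_Q1, neg_mul, mul_assoc, J_mul_J, mul_neg_one, neg_neg]
  have hQ2 : J * Q2 Q z * J = -Q2 Q z := by
    rw [J_mul_Q2 hherm, Q2_eq hherm, sigma2_eq, sub_mul, smul_mul_assoc, J_mul_J, smul_mul_assoc,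
      smul_mul_assoc, one_mul, smul_neg]
    abel
  rw [← Q1_add_Q2 hherm z, mul_add, add_mul, hQ1, hQ2, add_add_add_comm, add_neg_cancel, add_zero,
    ← two_smul ℂ, smul_smul, inv_mul_cancel₀ two_ne_zero, one_smul]

theorem isHermitian_Q1 (hherm : ∀ z, (Q z).IsHermitian) (z : ℝ) : (Q1 Q z).IsHermitian := by
  rw [Q1_eq hherm, IsHermitian, conjTranspose_smul, conjTranspose_add, conjTranspose_mul,
    conjTranspose_mul, conjTranspose_J, (hherm z).eq, star_inv₀, star_ofNat]
  noncomm_ring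

theorem matrixIntegral_smul_one_add_smul_sigma2 (f g : ℝ → ℝ) (a b : ℝ) :
    matrixIntegral (fun t => (f t : ℂ) • 1 + (g t : ℂ) • sigma2) a b
      = ((∫ t in a..b, f t : ℝ) : ℂ) • 1 + ((∫ t in a..b, g t : ℝ) : ℂ) • sigma2 := by
  ext i k
  fin_cases i <;> fin_cases k <;>
    simp [matrixIntegral, sigma2, intervalIntegral.integral_ofReal]

theorem meanQ2_eq (hherm : ∀ z, (Q z).IsHermitian) :
    meanQ2 Q = (meanHalfTrace Q : ℂ) • 1
      + ((⨍ t in (0 : ℝ)..Real.pi, (Q t 0 1).im : ℝ) : ℂ) • sigma2 := by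
  rw [meanQ2, funext (Q2_eq hherm), matrixIntegral_smul_one_add_smul_sigma2, smul_add, smul_smul,
    smul_smul, meanHalfTrace, interval_average_eq, interval_average_eq, sub_zero, one_div,
    smul_eq_mul, smul_eq_mul]
  push_cast
  rfl

theorem gaugeMatrix_eq (hherm : ∀ z, (Q z).IsHermitian) (z : ℝ) :
    ∃ c : ℂ, c ≠ 0 ∧ gaugeMatrix Q z = c • NormedSpace.exp ((angle Q z : ℂ) • J) := by
  set m : ℝ := ⨍ t in (0 : ℝ)..Real.pi, (Q t 0 1).im
  set g : ℝ := ∫ t in (0 : ℝ)..z, ((Q t 0 1).im - m)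
  have hsub : (fun t => Q2 Q t - meanQ2 Q) = fun t =>
      ((halfTrace Q t - meanHalfTrace Q : ℝ) : ℂ) • 1 + (((Q t 0 1).im - m : ℝ) : ℂ) • sigma2 := by
    funext t
    rw [Q2_eq hherm, meanQ2_eq hherm, Complex.ofReal_sub, Complex.ofReal_sub, sub_smul, sub_smul]
    abel
  have hexponent : J * matrixIntegral (fun t => Q2 Q t - meanQ2 Q) 0 z
      = (angle Q z : ℂ) • J + (-(g * Complex.I)) • 1 := by
    rw [hsub, matrixIntegral_smul_one_add_smul_sigma2, sigma2_eq, mul_add, mul_smul_comm, mul_one,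
      mul_smul_comm, mul_smul_comm, J_mul_J, smul_neg, smul_neg, smul_smul, neg_smul]
    rfl
  exact ⟨Complex.exp (-(g * Complex.I)), Complex.exp_ne_zero _,
    (congrArg NormedSpace.exp hexponent).trans (exp_add_smul_one _ _)⟩

/-- The off-trace part of `Q` in the gauge given by `gaugeMatrix Q`. -/
noncomputable def canonicalPotential (Q : ℝ → Matrix (Fin 2) (Fin 2) ℂ) (t : ℝ) :
    Matrix (Fin 2) (Fin 2) ℂ :=
  (gaugeMatrix Q t)⁻¹ * Q1 Q t * gaugeMatrix Q t

theorem canonicalPotential_eq (hherm : ∀ z, (Q z).IsHermitian) (z : ℝ) :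
    canonicalPotential Q z = NormedSpace.exp (-(angle Q z : ℂ) • J) * Q1 Q z
      * NormedSpace.exp ((angle Q z : ℂ) • J) := by
  obtain ⟨c, hc, hgauge⟩ := gaugeMatrix_eq hherm z
  have hinv : (gaugeMatrix Q z)⁻¹ = c⁻¹ • NormedSpace.exp (-(angle Q z : ℂ) • J) := by
    refine Matrix.inv_eq_right_inv ?_
    rw [hgauge, smul_mul_smul_comm, mul_inv_cancel₀ hc, one_smul, exp_smul_mul_exp_neg_smul]
  rw [canonicalPotential, hinv, hgauge, smul_mul_assoc, smul_mul_smul_comm, inv_mul_cancel₀ hc,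
    one_smul]

theorem canonicalPotential_congr (hherm : ∀ z, (Q z).IsHermitian) {x y : ℝ} (hQ : Q x = Q y)
    (hangle : angle Q x = angle Q y) : canonicalPotential Q x = canonicalPotential Q y := by
  rw [canonicalPotential_eq hherm, canonicalPotential_eq hherm, hangle, Q1, Q1, hQ]

/-- The inverse of the rotation in `gaugeMatrix Q`, with a scalar factor that makes it transform
the solutions of the system. -/
noncomputable def gaugeFactor (Q : ℝ → Matrix (Fin 2) (Fin 2) ℂ) (x : ℝ) :
    Matrix (Fin 2) (Fin 2) ℂ :=
  Complex.exp (Complex.I * (∫ t in (0 : ℝ)..x, (Q t 0 1).im : ℝ)) •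
    NormedSpace.exp (-(angle Q x : ℂ) • J)

theorem angle_zero : angle Q 0 = 0 :=
  intervalIntegral.integral_same

theorem gaugeFactor_zero : gaugeFactor Q 0 = 1 := by
  rw [gaugeFactor, angle_zero, intervalIntegral.integral_same, Complex.ofReal_zero, mul_zero,
    Complex.exp_zero, neg_zero, zero_smul, one_smul, NormedSpace.exp_zero]

theorem J_mul_gaugeFactor (z : ℝ) : J * gaugeFactor Q z = gaugeFactor Q z * J := by
  rw [gaugeFactor, mul_smul_comm, smul_mul_assoc, J_mul_exp_smul_J]

theorem canonicalPotential_mul_gaugeFactor (hherm : ∀ z, (Q z).IsHermitian) (z : ℝ) :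
    canonicalPotential Q z * gaugeFactor Q z = gaugeFactor Q z * Q1 Q z := by
  rw [canonicalPotential_eq hherm, gaugeFactor, mul_smul_comm, smul_mul_assoc, mul_assoc,
    exp_smul_mul_exp_neg_smul, mul_one]

section Integrable

variable (hQ : ∀ x y, IntervalIntegrable Q volume x y)

include hQ

theorem isPrimitive_angle : IsPrimitive (angle Q) (fun t => halfTrace Q t - meanHalfTrace Q) :=
  let reTrace : Matrix (Fin 2) (Fin 2) ℂ →L[ℝ] ℝ :=
    Complex.reCLM ∘L LinearMap.toContinuousLinearMap (traceLinearMap (Fin 2) ℝ ℂ)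
  .integral fun x y => .sub
    (⟨(reTrace.integrable_comp (hQ x y).1).div_const 2,
      (reTrace.integrable_comp (hQ x y).2).div_const 2⟩) intervalIntegrable_const

theorem isCanonicalPotential_canonicalPotential (hherm : ∀ z, (Q z).IsHermitian) :
    IsCanonicalPotential (canonicalPotential Q) where
  intervalIntegrable x y := by
    have hangle : Continuous fun t => (angle Q t : ℂ) :=
      Complex.continuous_ofReal.comp (isPrimitive_angle hQ).continuous
    have hQ1 : IntervalIntegrable (Q1 Q) volume x y := by
      rw [funext (Q1_eq hherm)]
      exact ((hQ x y).add (((hQ x y).continuousOn_mul continuousOn_const).mul_continuousOn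
        continuousOn_const)).smul (2⁻¹ : ℂ)
    rw [funext (canonicalPotential_eq hherm)]
    exact (hQ1.continuousOn_mul (continuous_exp_smul J hangle.neg).continuousOn).mul_continuousOn
      (continuous_exp_smul J hangle).continuousOn
  isHermitian t := by
    have hstar : ((angle Q t : ℂ) • J)ᴴ = -(angle Q t : ℂ) • J := by
      rw [conjTranspose_smul, conjTranspose_J, smul_neg, neg_smul, Complex.star_def,
        Complex.conj_ofReal]
    have hexp : NormedSpace.exp (-(angle Q t : ℂ) • J)
        = (NormedSpace.exp ((angle Q t : ℂ) • J))ᴴ :=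
      hstar ▸ Matrix.exp_conjTranspose _
    rw [canonicalPotential_eq hherm, hexp]
    exact isHermitian_conjTranspose_mul_mul _ (isHermitian_Q1 hherm t)
  anticommute t := by
    rw [canonicalPotential_eq hherm, ← mul_assoc, ← mul_assoc, J_mul_exp_smul_J, mul_assoc _ J,
      J_mul_Q1, mul_assoc _ _ J, ← J_mul_exp_smul_J]
    noncomm_ring

theorem isPrimitive_gaugeFactor :
    IsPrimitive (gaugeFactor Q) fun t => gaugeFactor Q t *
      (((Q t 0 1).im : ℂ) • Complex.I • 1 - ((halfTrace Q t - meanHalfTrace Q : ℝ) : ℂ) • J) := by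
  have hphase : IsPrimitive (fun t => ∫ s in (0 : ℝ)..t, (Q s 0 1).im) fun t => (Q t 0 1).im :=
    .integral fun x y =>
      ⟨Complex.imCLM.integrable_comp (intervalIntegrable_entry (hQ x y) 0 1).1,
        Complex.imCLM.integrable_comp (intervalIntegrable_entry (hQ x y) 0 1).2⟩
  have h := (isPrimitive_exp_smul hphase (Complex.I • (1 : Matrix (Fin 2) (Fin 2) ℂ))).mul
    (isPrimitive_exp_smul (isPrimitive_angle hQ) (-J))
  simp only [exp_smul_I_smul_one, smul_neg, ← neg_smul, smul_one_mul] at h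
  exact h.congr (.of_forall fun t => by
    simp only [gaugeFactor, smul_mul_assoc, mul_smul_comm, one_mul, mul_one, mul_sub, neg_smul,
      mul_neg]
    module)

theorem gaugeFactor_mul_eq_transferMatrix (hherm : ∀ z, (Q z).IsHermitian) {lam : ℂ}
    {Y : ℝ → Matrix (Fin 2) (Fin 2) ℂ} (hY : IsFundamentalMatrix Q lam Y) (x : ℝ) :
    gaugeFactor Q x * Y x = transferMatrix (canonicalPotential Q) (lam - meanHalfTrace Q) x := by
  have hcoeff : ∀ t, (((Q t 0 1).im : ℂ) • Complex.I • 1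
        - ((halfTrace Q t - meanHalfTrace Q : ℝ) : ℂ) • J) + J * (Q t - lam • 1)
      = J * Q1 Q t - (lam - meanHalfTrace Q) • J := by
    intro t
    have hJQ : J * Q t = J * Q1 Q t + J * Q2 Q t := by rw [← mul_add, Q1_add_Q2 hherm]
    rw [mul_sub, hJQ, J_mul_Q2 hherm, mul_smul_comm, mul_one, Complex.ofReal_sub]
    module
  have hderiv := ((isPrimitive_gaugeFactor hQ).mul (hY.isPrimitive hQ)).congr (g := fun t =>
    (J * canonicalPotential Q t - (lam - meanHalfTrace Q) • J) * (gaugeFactor Q t * Y t))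
      (.of_forall fun t => by
        have hJ := J_mul_gaugeFactor (Q := Q) t
        have hP := canonicalPotential_mul_gaugeFactor hherm t
        calc _ = gaugeFactor Q t * ((((Q t 0 1).im : ℂ) • Complex.I • 1
              - ((halfTrace Q t - meanHalfTrace Q : ℝ) : ℂ) • J) + J * (Q t - lam • 1)) * Y t := by
              noncomm_ring
          _ = _ := by
              rw [hcoeff, mul_sub, mul_smul_comm, ← hJ, ← mul_assoc _ J, ← hJ, mul_assoc J, ← hP]
              simp only [sub_mul, mul_assoc, smul_mul_assoc])
  have h := eq_propagator_mul
    ((isCanonicalPotential_canonicalPotential hQ hherm).intervalIntegrable_coeff _) hderiv x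
  rwa [gaugeFactor_zero, hY.initial, mul_one, mul_one] at h

theorem angle_pi : angle Q Real.pi = 0 := by
  have h := (isPrimitive_angle hQ).intervalIntegrable 0 Real.pi
  have hint : IntervalIntegrable (halfTrace Q) volume 0 Real.pi := by
    simpa using h.add (intervalIntegrable_const (c := meanHalfTrace Q))
  rw [angle, intervalIntegral.integral_sub hint intervalIntegrable_const,
    intervalIntegral.integral_const, meanHalfTrace, interval_average_eq, sub_zero, smul_smul,
    mul_inv_cancel₀ Real.pi_ne_zero, one_smul, sub_self]

theorem angle_const_add {s : ℝ} (hs : ∀ᵐ z, Q (z + s) = Q z) (x : ℝ) :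
    angle Q (s + x) = angle Q x + angle Q s := by
  have hconst := (((isPrimitive_angle hQ).comp_const_add s).sub (isPrimitive_angle hQ)).congr
    (g := fun _ => 0) (by
      filter_upwards [hs] with z hz
      rw [add_comm s z, halfTrace, halfTrace, hz, sub_self])
  have h := hconst.eq_of_zero x
  rw [add_zero, angle_zero, sub_zero] at h
  exact sub_eq_iff_eq_add'.1 h

end Integrable

theorem periodic_angle (hper : Function.Periodic Q Real.pi)
    (hQ : ∀ x y, IntervalIntegrable Q volume x y) : Function.Periodic (angle Q) Real.pi :=
  fun z => by rw [add_comm, angle_const_add hQ (.of_forall hper), angle_pi hQ, add_zero]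

theorem periodic_canonicalPotential (hherm : ∀ z, (Q z).IsHermitian)
    (hper : Function.Periodic Q Real.pi) (hQ : ∀ x y, IntervalIntegrable Q volume x y) :
    Function.Periodic (canonicalPotential Q) Real.pi :=
  fun z => canonicalPotential_congr hherm (hper z) (periodic_angle hper hQ z)

theorem transformedPotential_ae_eq_translate (hherm : ∀ z, (Q z).IsHermitian)
    (hQ : ∀ x y, IntervalIntegrable Q volume x y)
    (hhalf : ∀ᵐ z : ℝ, Q (z + Real.pi / 2) = Q z) :
    ∀ᵐ z : ℝ, transformedPotential Q (z + Real.pi / 2) = transformedPotential Q z := by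
  have hangle : angle Q (Real.pi / 2) = 0 := by
    have h := angle_const_add hQ hhalf (Real.pi / 2)
    rw [add_halves, angle_pi hQ] at h
    linarith
  filter_upwards [hhalf] with z hz
  refine congrArg (· + meanQ2 Q) (canonicalPotential_congr hherm hz ?_)
  rw [add_comm, angle_const_add hQ hhalf, hangle, add_zero]

theorem discriminant_add_eq (hherm : ∀ z, (Q z).IsHermitian)
    (hper : Function.Periodic Q Real.pi)
    (hint : ∀ i j, IntegrableOn (fun z => Q z i j) (Ico 0 Real.pi)) (lam : ℂ) :
    discriminant Q lam + 2 * phase Q = phase Q *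
      ((transferMatrix (canonicalPotential Q) (lam - meanHalfTrace Q) Real.pi).trace + 2) := by
  have hQ := intervalIntegrable_of_periodic hper hint
  have hphase : phase Q * Complex.exp (Complex.I * (∫ t in (0 : ℝ)..Real.pi, (Q t 0 1).im : ℝ))
      = 1 := by
    rw [phase, ← Complex.exp_add, neg_mul, neg_add_cancel, Complex.exp_zero]
  rw [← gaugeFactor_mul_eq_transferMatrix hQ hherm
    (isFundamentalMatrix_fundamentalMatrix Q hper hint lam), gaugeFactor, angle_pi hQ,
    Complex.ofReal_zero, neg_zero, zero_smul, NormedSpace.exp_zero, smul_one_mul, trace_smul,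
    mul_add, smul_eq_mul, ← mul_assoc, hphase, one_mul, mul_comm (phase Q) 2]
  rfl

theorem onlyDoubleZeros_discriminant_iff (hherm : ∀ z, (Q z).IsHermitian)
    (hper : Function.Periodic Q Real.pi)
    (hint : ∀ i j, IntegrableOn (fun z => Q z i j) (Ico 0 Real.pi)) :
    OnlyDoubleZeros (fun lam => discriminant Q lam + 2 * phase Q) ↔
      OnlyDoubleZeros fun lam =>
        (transferMatrix (canonicalPotential Q) lam (Real.pi / 2 + Real.pi / 2)).trace + 2 := by
  have hP := isCanonicalPotential_canonicalPotential
    (intervalIntegrable_of_periodic hper hint) hherm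
  rw [funext (discriminant_add_eq hherm hper hint), add_halves]
  exact onlyDoubleZeros_const_mul_comp_sub_iff
    ((hP.differentiable_trace_transferMatrix Real.pi_pos.le).add_const 2) (Complex.exp_ne_zero _) _

end Gauge
end DiracSystem

open DiracSystem in
theorem theorem5p1_general (Q : ℝ → Matrix (Fin 2) (Fin 2) ℂ)
    (hherm : ∀ z, (Q z).IsHermitian)
    (hper : Function.Periodic Q Real.pi)
    (hint : ∀ i j, MeasureTheory.IntegrableOn (fun z => Q z i j) (Set.Ico 0 Real.pi)) :
    OnlyDoubleZeros (fun lam => discriminant Q lam + 2 * phase Q) ↔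
      ∀ᵐ z : ℝ, transformedPotential Q (z + Real.pi / 2) = transformedPotential Q z := by
  have hQ := intervalIntegrable_of_periodic hper hint
  have hP := isCanonicalPotential_canonicalPotential hQ hherm
  have hPper : Function.Periodic (canonicalPotential Q) (Real.pi / 2 + Real.pi / 2) := by
    rw [add_halves]
    exact periodic_canonicalPotential hherm hper hQ
  rw [onlyDoubleZeros_discriminant_iff hherm hper hint]
  refine ⟨fun hzeros => ?_, fun hhalf => hP.onlyDoubleZeros_trace_add_two Real.pi_div_two_pos ?_⟩
  · filter_upwards [ae_eq_translate_of_periodic Real.pi_div_two_pos hPper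
      (hP.ae_eq_translate_of_onlyDoubleZeros hzeros)] with z hz
    exact congrArg (· + meanQ2 Q) hz
  · filter_upwards [hhalf] with z hz
    rw [add_comm]
    exact (add_left_injective (meanQ2 Q) hz).symm

open DiracSystem in
theorem theorem5p1 (Q : ℝ → Matrix (Fin 2) (Fin 2) ℂ)
    (hherm : ∀ z, (Q z).IsHermitian)
    (hper : Function.Periodic Q Real.pi)
    (hint : ∀ i j, MeasureTheory.IntegrableOn (fun z => Q z i j) (Set.Ico 0 Real.pi)) :
    ((∀ᵐ z : ℝ, Q (z + Real.pi / 2) = Q z) →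
      DiracSystem.OnlyDoubleZeros
        (fun lam => DiracSystem.discriminant Q lam + 2 * DiracSystem.phase Q)) ∧
    (DiracSystem.OnlyDoubleZeros
        (fun lam => DiracSystem.discriminant Q lam + 2 * DiracSystem.phase Q) →
      ∀ᵐ z : ℝ, DiracSystem.transformedPotential Q (z + Real.pi / 2)
        = DiracSystem.transformedPotential Q z) := by
  have hequiv := theorem5p1_general Q hherm hper hint
  exact ⟨fun hhalf => hequiv.2 (transformedPotential_ae_eq_translate hherm
    (intervalIntegrable_of_periodic hper hint) hhalf), hequiv.1⟩
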